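/- Let $V_n=\mathbb{C}^n$, with $V_0\subset V_1\subset V_2\subset\cdots$ the standard inclusions (onto the span of the first basis vectors). For integers $0\le r\le k$ and $s\ge 1$ let $$\sigma_s^r\operatorname{Gr}(k,V_n)=\overline{\Big\{[\lambda_1\widehat E_1+\cdots+\lambda_s\widehat E_s]\ :\ E_1,\dots,E_s\in \operatorname{Gr}(k,V_n),\ \dim(E_1\cap\cdots\cap E_s)\ge r\Big\}}\subset\mathbb{P}\big(\textstyle\bigwedge^k V_n\big)$$ (Zariski closure) be the $r$-restricted $s$-secant variety of the Grassmannian, where $\widehat E\in\bigwedge^k V_n$ is a vector representing the Plücker point of $E$, $\lambda_i\in\mathbb{C}$, and only nonzero sums are considered. The family $(\sigma_s^r\operatorname{Gr}(k,V_n))_{n\ge 0}$ has orbit stability at step $p$ if $\operatorname{GL}(V_j).\sigma_s^r\operatorname{Gr}(k,V_i)=\sigma_s^r\operatorname{Gr}(k,V_j)$ whenever $p\le i\le j$. The family has orbit stability at step $r+s(k-r)$. Let $p$ be the first step at which it has orbit stability. Then: 1. $p=r+s(k-r)$, unless $s\ge 2$ and $k=r+1$ (the case in which $\sigma_s^r\operatorname{Gr}(k,V_n)=\operatorname{Gr}(k,V_n)$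 collapses). 2. For all $n\ge p$, $$\dim \sigma_s^r\operatorname{Gr}(k,V_n)=\dim\sigma_s^r\operatorname{Gr}(k,V_p)+\dim\operatorname{Gr}(p,n).$$ 3. If $s\ge 2$ and $k-r\ge 3$, or if $s=1$ and $r\in\{0,k\}$, then for all $n\ge p$, $$\dim \sigma_s^r\operatorname{Gr}(k,V_n)=r(p-r)+s(k-r)(p-k)+s-1+p(n-p).$$ -/

import Mathlib

open scoped LinearAlgebra.Projectivization

noncomputable section

namespace RestrictedSecant

/-! ### Projective varieties in a complex projective space with linear coordinates -/

section ProjectiveGeometry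

variable {ι W : Type*} [AddCommGroup W] [Module ℂ W]

/-- The Zariski closure of a subset `S` of `ℙ(W)`, with respect to the homogeneous coordinates given
by the basis `b` of `W`: the common zeros of all homogeneous polynomials vanishing on `S`.
(The vanishing of a homogeneous polynomial at a point does not depend on the representative.) -/
def zariskiClosure (b : Module.Basis ι ℂ W) (S : Set (ℙ ℂ W)) : Set (ℙ ℂ W) :=
  {x | ∀ (d : ℕ) (F : MvPolynomial ι ℂ), F.IsHomogeneous d →
    (∀ y ∈ S, MvPolynomial.eval (b.repr y.rep) F = 0) →
      MvPolynomial.eval (b.repr x.rep) F = 0}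

/-- The affine cone over `X ⊆ ℙ(W)` (without its vertex, which changes nothing for the vanishing
ideal when `X` is nonempty), in the coordinates given by `b`. -/
def affineCone (b : Module.Basis ι ℂ W) (X : Set (ℙ ℂ W)) : Set (ι → ℂ) :=
  {c | ∃ (w : W) (hw : w ≠ 0), Projectivization.mk ℂ w hw ∈ X ∧ c = b.repr w}

/-- The homogeneous coordinate ring of `X ⊆ ℙ(W)`, that is, the coordinate ring of the affine cone
over `X`. It only depends on the Zariski closure of `X`. -/
abbrev CoordinateRing (b : Module.Basis ι ℂ W) (X : Set (ℙ ℂ W)) : Type _ :=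
  MvPolynomial ι ℂ ⧸ MvPolynomial.vanishingIdeal ℂ (affineCone b X)

/-- The dimension of a projective variety `X`: the dimension of its affine cone (the Krull dimension
of the coordinate ring of the cone) minus one. The empty variety has dimension `⊥`. -/
def projDim (b : Module.Basis ι ℂ W) (X : Set (ℙ ℂ W)) : WithBot ℕ∞ :=
  WithBot.map (fun d : ℕ∞ => d - 1) (ringKrullDim (CoordinateRing b X))

end ProjectiveGeometry

/-! ### Grassmannians and their restricted secant varieties -/

/-- The vector space `V_n = ℂⁿ`. -/
abbrev V (n : ℕ) : Type := Fin n → ℂ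

/-- The basis of Plücker coordinates `e_{i_1} ∧ ⋯ ∧ e_{i_k}`, `i_1 < ⋯ < i_k`, of `⋀ᵏ V_n`. -/
def pluckerBasis (k n : ℕ) :
    Module.Basis (Set.powersetCard (Fin n) k) ℂ (⋀[ℂ]^k (V n)) :=
  (Pi.basisFun ℂ (Fin n)).exteriorPower k

/-- `ω = e_1 ∧ ⋯ ∧ e_k` for some basis `e_1, …, e_k` of the `k`-plane `E`: a representative in
`⋀ᵏ V_n` of the Plücker point of `E`. In particular `E` has dimension `k`. -/
def IsPluckerRep {k n : ℕ} (E : Submodule ℂ (V n)) (ω : ⋀[ℂ]^k (V n)) : Prop :=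
  ∃ e : Fin k → V n, LinearIndependent ℂ e ∧ Submodule.span ℂ (Set.range e) = E ∧
    ω = exteriorPower.ιMulti ℂ k e

/-- The Grassmannian `Gr(k, V_n)` in its Plücker embedding in `ℙ(⋀ᵏ V_n)`. -/
def grassmannian (k n : ℕ) : Set (ℙ ℂ (⋀[ℂ]^k (V n))) :=
  {x | ∃ (E : Submodule ℂ (V n)) (ω : ⋀[ℂ]^k (V n)) (hω : ω ≠ 0),
    IsPluckerRep E ω ∧ x = Projectivization.mk ℂ ω hω}

/-- The points `[λ_1 Ê_1 + ⋯ + λ_s Ê_s]` of `ℙ(⋀ᵏ V_n)` where `E_1, …, E_s` are `k`-planes of `V_n`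
with `dim (E_1 ∩ ⋯ ∩ E_s) ≥ r`. -/
def restrictedSecantPoints (k r s n : ℕ) : Set (ℙ ℂ (⋀[ℂ]^k (V n))) :=
  {x | ∃ (E : Fin s → Submodule ℂ (V n)) (ω : Fin s → ⋀[ℂ]^k (V n)) (c : Fin s → ℂ)
      (h : ∑ i, c i • ω i ≠ 0),
    (∀ i, IsPluckerRep (E i) (ω i)) ∧
    r ≤ Module.finrank ℂ (⨅ i, E i : Submodule ℂ (V n)) ∧
    x = Projectivization.mk ℂ (∑ i, c i • ω i) h}

/-- The `r`-restricted `s`-secant variety `σ_s^r(Gr(k, V_n)) ⊆ ℙ(⋀ᵏ V_n)`. -/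
def restrictedSecant (k r s n : ℕ) : Set (ℙ ℂ (⋀[ℂ]^k (V n))) :=
  zariskiClosure (pluckerBasis k n) (restrictedSecantPoints k r s n)

/-! ### The orbit family and orbit stability -/

/-- The inclusion `V_i ⊆ V_j` for `i ≤ j`, onto the span of the first `i` basis vectors. -/
def incl {i j : ℕ} (hij : i ≤ j) : V i →ₗ[ℂ] V j :=
  Function.ExtendByZero.linearMap ℂ (Fin.castLE hij)

theorem incl_injective {i j : ℕ} (hij : i ≤ j) : Function.Injective (incl hij) := by
  intro x y h
  exact Function.extend_injective (Fin.castLE_injective hij) (0 : Fin j → ℂ) h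

/-- The set `GL(V_j).X` of all translates under `GL(V_j)` of the points of `X ⊆ ℙ(⋀ᵏ V_i)`, where
`ℙ(⋀ᵏ V_i)` is regarded as a subspace of `ℙ(⋀ᵏ V_j)` through the inclusion `V_i ⊆ V_j`. -/
def glTranslates {k i j : ℕ} (hij : i ≤ j) (X : Set (ℙ ℂ (⋀[ℂ]^k (V i)))) :
    Set (ℙ ℂ (⋀[ℂ]^k (V j))) :=
  {x | ∃ g : V j ≃ₗ[ℂ] V j, ∃ y ∈ X,
    x = Projectivization.map (exteriorPower.map k (g.toLinearMap ∘ₗ incl hij))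
      (exteriorPower.map_injective_field (g.injective.comp (incl_injective hij))) y}

/-- Orbit stability of the family `(σ_s^r Gr(k, V_i))_i` occurs at step `p`:
`GL(V_j).σ_s^r Gr(k, V_i) = σ_s^r Gr(k, V_j)` whenever `p ≤ i ≤ j`. -/
def OrbitStableAt (k r s p : ℕ) : Prop :=
  ∀ (i j : ℕ) (hij : i ≤ j), p ≤ i →
    glTranslates hij (restrictedSecant k r s i) = restrictedSecant k r s j

end RestrictedSecant

end

noncomputable section

namespace RestrictedSecant

/-! ### Krull dimension and transcendence degree -/

/-! Write m = k - r and N = r + s m. A point of the restricted secant set is built from r common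
vectors and m further vectors for each of the s planes, so it is a form on a subspace spanned by N
vectors.

Stability. Contracting such a form with linear functionals gives a map of rank at most N. This is a
determinantal condition, so it persists on the Zariski closure (`finrank_range_contraction_le`). A
form on V_{i+e} with i ≥ N is then killed by e independent functionals; a change of basis makes them
the last coordinates, and the form comes from V_i (`orbitStableAt`). If s = 1 or m ≥ 2, the sum of
coordinate forms on N distinct basis vectors has injective contraction, so it is not a translate of
a form on V_{N-1} (`not_orbitStableAt`). If s = 1 or m ≤ 1, every secant vector is decomposable and
the variety is Gr(k, n), which is also the case r = k, s = 1 (`restrictedSecant_eq_of_degenerate`).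

Dimension. The cone is parametrized by polynomials, so its dimension is the transcendence degree of
the algebra generated by the Plücker coordinates. N generic vectors of V_{N+e} span the graph of a
linear map V_N → V_e. The N e entries of this map are algebraic over the Plücker algebra by Cramer's
rule, so they add exactly N e = dim Gr(N, N+e) to the dimension found in V_N
(`trdeg_pluckerAlgebra_graph`).

The explicit number comes from an affine chart in V_N. For m ≥ 3, suitable Plücker coordinates have
the identity as Jacobian matrix at the origin of the chart (`chartDeriv_chartCoord`), so no
parameter is lost. The degenerate chart s = 1, m = 0 is a single point and yields the dimension of
the Grassmannian itself. -/

theorem ringKrullDim_eq_of_isIntegral {R S : Type*} [CommRing R] [CommRing S] [Algebra R S]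
    [Algebra.IsIntegral R S] (hinj : Function.Injective (algebraMap R S)) :
    ringKrullDim S = ringKrullDim R := by
  apply le_antisymm
  · refine Order.krullDim_le_of_strictMono (PrimeSpectrum.comap (algebraMap R S)) ?_
    intro p q hpq
    exact Ideal.IsIntegral.comap_lt_comap (R := R) hpq
  · refine iSup_le fun l => ?_
    -- Lying over, available because the kernel is zero, lifts the bottom of the chain; going up
    -- lifts the rest.
    obtain ⟨Q, -, hQ, hcomap⟩ := Ideal.exists_ideal_over_prime_of_isIntegral
      (S := S) l.head.asIdeal ⊥ (by
        rw [← RingHom.ker_eq_comap_bot, (RingHom.injective_iff_ker_eq_bot _).1 hinj]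
        exact bot_le)
    have : Q.LiesOver l.head.asIdeal := ⟨hcomap.symm⟩
    obtain ⟨L, hL, -⟩ := Ideal.exists_ltSeries_of_hasGoingUp l Q
    exact le_iSup_of_le L (by rw [hL])

/-- Noether normalization: an integral extension of a polynomial ring shares both its Krull
dimension and its transcendence degree, the number of variables. -/
theorem ringKrullDim_eq_trdeg {K A : Type} [Field K] [CommRing A] [IsDomain A] [Algebra K A]
    [Algebra.FiniteType K A] {d : ℕ} (hd : Algebra.trdeg K A = d) :
    ringKrullDim A = d := by
  obtain ⟨m, g, hg, hint⟩ := exists_integral_inj_algHom_of_fg K A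
  algebraize [g.toRingHom]
  have : Algebra.IsIntegral (MvPolynomial (Fin m) K) A := ⟨hint⟩
  have hinj : Function.Injective (algebraMap (MvPolynomial (Fin m) K) A) := hg
  have hf : FaithfulSMul (MvPolynomial (Fin m) K) A :=
    (faithfulSMul_iff_algebraMap_injective _ _).2 hinj
  have : IsScalarTower K (MvPolynomial (Fin m) K) A :=
    IsScalarTower.of_algebraMap_eq fun x => (g.commutes x).symm
  have h1 := trdeg_add_eq K (MvPolynomial (Fin m) K) (A := A)
  have h0 : Algebra.trdeg (MvPolynomial (Fin m) K) A = 0 := trdeg_eq_zero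
  rw [h0, add_zero, MvPolynomial.trdeg_of_isDomain, hd] at h1
  have hm : m = d := by simpa using h1
  rw [ringKrullDim_eq_of_isIntegral hinj, MvPolynomial.ringKrullDim_of_isNoetherianRing,
    ringKrullDim_eq_zero_of_field, hm]
  simp

/-! ### The Jacobian criterion -/

open MvPolynomial in
theorem totalDegree_pderiv_lt {K ι : Type*} [Field K] {F : MvPolynomial ι K} {d : ι}
    (h : pderiv d F ≠ 0) :
    (pderiv d F).totalDegree < F.totalDegree := by
  have hpos : ∀ m ∈ (pderiv d F).support, m.degree < F.totalDegree := by
    intro m hm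
    rw [mem_support_iff, coeff_pderiv] at hm
    have h1 := le_totalDegree (mem_support_iff.2 (left_ne_zero_of_mul hm))
    have h2 : (m + Finsupp.single d 1).degree ≤ F.totalDegree := h1
    simp at h2
    omega
  obtain ⟨m, hm⟩ := support_nonempty.2 h
  rw [totalDegree, Finset.sup_lt_iff ((Nat.zero_le _).trans_lt (hpos m hm))]
  exact hpos

-- Derivatives of determinants can thus be read off from their values on coordinate lines, without
-- differentiating formally.
open MvPolynomial in
theorem eval_pderiv_of_line {K σ : Type*} [Field K] [CharZero K]
    [DecidableEq σ] {P : MvPolynomial σ K} {z : σ → K} {i : σ} {a c : K}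
    (h : ∀ τ : K, eval (z + Pi.single i τ) P = a + c * τ) : eval z (pderiv i P) = c := by
  let L : MvPolynomial σ K →ₐ[K] Polynomial K :=
    aeval fun j => Polynomial.C (z j) + Pi.single (M := fun _ => Polynomial K) i Polynomial.X j
  have hL : ∀ (τ : K) (Q : MvPolynomial σ K), (L Q).eval τ = eval (z + Pi.single i τ) Q := by
    intro τ Q
    have : (Polynomial.evalRingHom τ).comp (L : MvPolynomial σ K →+* Polynomial K) =
        eval (z + Pi.single i τ) := by
      apply MvPolynomial.ringHom_ext
      · intro a; simp [L]
      · intro j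
        by_cases hj : j = i
        · subst hj; simp [L]
        · simp [L, hj]
    exact congrArg (fun f => f Q) this
  have hder : ∀ Q : MvPolynomial σ K, Polynomial.derivative (L Q) = L (pderiv i Q) := by
    intro Q
    induction Q using MvPolynomial.induction_on with
    | C a => simp [L]
    | add p q hp hq => simp [hp, hq]
    | mul_X p e hp =>
      simp only [map_mul, Derivation.leibniz, smul_eq_mul, Polynomial.derivative_mul, hp, map_add,
        pderiv_X]
      by_cases he : e = i
      · subst he; simp [L]; ring
      · simp [L, he]; ring
  have hP : L P = Polynomial.C a + Polynomial.C c * Polynomial.X := by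
    apply Polynomial.funext
    intro τ
    rw [hL, h]; simp
  have h0 := hL 0 (pderiv i P)
  rw [← hder, hP] at h0
  simpa using h0.symm

section Jacobian

variable {K : Type*} [Field K] {σ ι : Type*} [Fintype ι] [DecidableEq ι]

open MvPolynomial

theorem pderiv_aeval (P : ι → MvPolynomial σ K) (F : MvPolynomial ι K) (i : σ) :
    pderiv i (aeval P F) = ∑ d, aeval P (pderiv d F) * pderiv i (P d) := by
  classical
  induction F using MvPolynomial.induction_on with
  | C a => simp [algebraMap_eq]
  | add p q hp hq => simp only [map_add, hp, hq, add_mul, Finset.sum_add_distrib]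
  | mul_X p e hp =>
    simp only [map_mul, aeval_X, Derivation.leibniz, smul_eq_mul, hp, pderiv_X, map_add, add_mul,
      Finset.sum_add_distrib, Finset.mul_sum]
    congr 1
    · rw [Finset.sum_eq_single e]
      · simp
      · intro b _ hb; simp [hb.symm]
      · simp
    · exact Finset.sum_congr rfl fun _ _ => by ring

variable [CharZero K]

theorem eq_C_of_pderiv_eq_zero {F : MvPolynomial ι K} (h : ∀ d, pderiv d F = 0) :
    F = C (coeff 0 F) := by
  ext m
  rw [coeff_C]
  split_ifs with hm
  · rw [hm]
  · obtain ⟨d, hd⟩ : ∃ d, m d ≠ 0 := by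
      by_contra! hc
      exact hm (Finsupp.ext hc).symm
    have h1 := congrArg (coeff (m - Finsupp.single d 1)) (h d)
    have h2 : m - Finsupp.single d 1 + Finsupp.single d 1 = m := by
      ext e
      by_cases he : e = d
      · subst he; simp; omega
      · simp [Ne.symm he]
    rw [coeff_pderiv, h2, coeff_zero] at h1
    exact (mul_eq_zero.1 h1).resolve_right (Nat.cast_add_one_ne_zero _)

/-- Polynomials whose Jacobian matrix contains an identity matrix at some point are algebraically
independent. -/
theorem algebraicIndependent_of_jacobian (P : ι → MvPolynomial σ K) (j : ι → σ) (z : σ → K)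
    (hJ : ∀ d d', eval z (pderiv (j d') (P d)) = if d = d' then 1 else 0) :
    AlgebraicIndependent K P := by
  have hdet : (Matrix.of fun d' d => pderiv (j d') (P d)).det ≠ 0 := by
    intro h0
    have h1 := congrArg (eval z) h0
    rw [RingHom.map_det, map_zero] at h1
    have h2 : (eval z).mapMatrix (Matrix.of fun d' d => pderiv (j d') (P d)) = 1 := by
      ext d' d
      simp [hJ, Matrix.one_apply, eq_comm]
    rw [h2, Matrix.det_one] at h1
    exact one_ne_zero h1
  rw [algebraicIndependent_iff]
  -- Induction on the degree of a relation F. By the chain rule the vector of the ∂F/∂d, evaluated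
  -- at P, is in the kernel of the Jacobian matrix, which has nonzero determinant. So the partial
  -- derivatives are relations of smaller degree, hence zero, and F is constant in characteristic
  -- zero.
  suffices H : ∀ (N : ℕ) (F : MvPolynomial ι K), F.totalDegree ≤ N → aeval P F = 0 → F = 0 from
    fun F => H _ F le_rfl
  intro N
  induction N with
  | zero =>
    intro F hF h
    rw [Nat.le_zero, totalDegree_eq_zero_iff_eq_C] at hF
    rw [hF] at h ⊢
    simpa using h
  | succ N ih =>
    intro F hF h
    have hv : (fun d => aeval P (pderiv d F)) = 0 := by
      apply Matrix.eq_zero_of_mulVec_eq_zero hdet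
      ext1 d'
      have := pderiv_aeval P F (j d')
      rw [h, map_zero] at this
      simp only [Matrix.mulVec, dotProduct, Matrix.of_apply, Pi.zero_apply]
      rw [this]
      exact Finset.sum_congr rfl fun _ _ => mul_comm _ _
    have hz : ∀ d, pderiv d F = 0 := by
      intro d
      by_contra hne
      exact hne (ih _ (by have := totalDegree_pderiv_lt hne; omega) (congrFun hv d))
    have hC := eq_C_of_pderiv_eq_zero hz
    rw [hC] at h ⊢
    simpa using h

end Jacobian

/-- A polynomial vanishing wherever a nonzero polynomial `g` does not vanish is zero. -/
theorem eq_zero_of_eval_eq_zero_of_ne {K σ : Type*} [Field K] [Infinite K]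
    {f g : MvPolynomial σ K} (hg : g ≠ 0)
    (h : ∀ z, MvPolynomial.eval z g ≠ 0 → MvPolynomial.eval z f = 0) : f = 0 := by
  have : g * f = 0 := by
    apply MvPolynomial.funext
    intro z
    by_cases hz : MvPolynomial.eval z g = 0
    · simp [hz]
    · simp [h z hz]
  exact (mul_eq_zero.1 this).resolve_left hg

/-! ### Affine cones -/

section Cones

open MvPolynomial

variable {ι W : Type*} [AddCommGroup W] [Module ℂ W]

theorem eval_smul_of_isHomogeneous {F : MvPolynomial ι ℂ} {d : ℕ} (hF : F.IsHomogeneous d)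
    (c : ℂ) (x : ι → ℂ) : eval (c • x) F = c ^ d * eval x F := by
  rw [eval_eq, eval_eq, Finset.mul_sum]
  refine Finset.sum_congr rfl fun m hm => ?_
  have hd : ∑ i ∈ m.support, m i = d := by
    simpa [Finsupp.degree, Finsupp.weight, Finsupp.linearCombination_apply, Finsupp.sum] using
      hF (mem_support_iff.1 hm)
  simp only [Pi.smul_apply, smul_eq_mul, mul_pow, Finset.prod_mul_distrib]
  rw [Finset.prod_pow_eq_pow_sum, hd]
  ring

theorem eval_rep_eq_zero_iff (b : Module.Basis ι ℂ W) {F : MvPolynomial ι ℂ} {d : ℕ}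
    (hF : F.IsHomogeneous d) (w : W) (hw : w ≠ 0) :
    eval (b.repr (Projectivization.mk ℂ w hw).rep) F = 0 ↔ eval (b.repr w) F = 0 := by
  obtain ⟨a, ha⟩ := Projectivization.exists_smul_eq_mk_rep ℂ w hw
  have ha0 : (a : ℂ) ≠ 0 := a.ne_zero
  rw [← ha, Units.smul_def, map_smul, Finsupp.coe_smul, eval_smul_of_isHomogeneous hF]
  simp [ha0]

theorem mk_mem_zariskiClosure_iff (b : Module.Basis ι ℂ W) (S : Set (ℙ ℂ W)) (w : W)
    (hw : w ≠ 0) : Projectivization.mk ℂ w hw ∈ zariskiClosure b S ↔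
      ∀ (d : ℕ) (F : MvPolynomial ι ℂ), F.IsHomogeneous d →
        (∀ c ∈ affineCone b S, eval c F = 0) → eval (b.repr w) F = 0 := by
  refine forall₃_congr fun d F hF => ?_
  rw [eval_rep_eq_zero_iff b hF]
  refine imp_congr_left ⟨?_, ?_⟩
  · rintro h _ ⟨v, hv, hvS, rfl⟩
    exact (eval_rep_eq_zero_iff b hF v hv).1 (h _ hvS)
  · intro h y hy
    exact h _ ⟨y.rep, y.rep_nonzero, by rwa [Projectivization.mk_rep], rfl⟩

theorem subset_zariskiClosure (b : Module.Basis ι ℂ W) (S : Set (ℙ ℂ W)) :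
    S ⊆ zariskiClosure b S :=
  fun _ hx _ _ _ h => h _ hx

theorem smul_mem_affineCone {b : Module.Basis ι ℂ W} {S : Set (ℙ ℂ W)} {c : ι → ℂ}
    (hc : c ∈ affineCone b S) {a : ℂ} (ha : a ≠ 0) : a • c ∈ affineCone b S := by
  obtain ⟨w, hw, hS, rfl⟩ := hc
  refine ⟨a • w, smul_ne_zero ha hw, ?_, by simp⟩
  rwa [(Projectivization.mk_eq_mk_iff' ℂ _ _ (smul_ne_zero ha hw) hw).2 ⟨a, rfl⟩]

/-- As a function of a, F(a c) is a polynomial whose coefficients are the values F_d(c), and it has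
infinitely many zeros. -/
theorem eval_homogeneousComponent_eq_zero {F : MvPolynomial ι ℂ} {c : ι → ℂ}
    (h : ∀ a : ℂ, a ≠ 0 → eval (a • c) F = 0) (d : ℕ) :
    eval c (homogeneousComponent d F) = 0 := by
  let p : Polynomial ℂ := ∑ i ∈ Finset.range (F.totalDegree + 1),
    Polynomial.C (eval c (homogeneousComponent i F)) * Polynomial.X ^ i
  have hp : ∀ a, p.eval a = eval (a • c) F := by
    intro a
    conv_rhs => rw [← sum_homogeneousComponent F]
    simp only [p, Polynomial.eval_finsetSum, map_sum]
    refine Finset.sum_congr rfl fun i _ => ?_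
    rw [eval_smul_of_isHomogeneous (homogeneousComponent_isHomogeneous i F)]
    simp only [Polynomial.eval_mul, Polynomial.eval_C, Polynomial.eval_pow, Polynomial.eval_X]
    ring
  -- The factor X takes care of the excluded value a = 0.
  have hp0 : Polynomial.X * p = 0 := by
    apply Polynomial.funext
    intro a
    by_cases ha : a = 0
    · simp [ha]
    · simp [hp, h a ha]
  have hp1 : p = 0 := (mul_eq_zero.1 hp0).resolve_left Polynomial.X_ne_zero
  by_cases hd : d < F.totalDegree + 1
  · have := congrArg (fun q => Polynomial.coeff q d) hp1
    simpa [p, Polynomial.finsetSum_coeff, Polynomial.coeff_C_mul, Polynomial.coeff_X_pow,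
      Finset.sum_ite_eq, hd] using this
  · rw [homogeneousComponent_eq_zero _ _ (by omega), map_zero]

/-- A cone is stable under nonzero scalars, so its ideal is generated by homogeneous polynomials,
and these are the ones that define the closure. Dimensions can therefore be computed on the
parametrized points. -/
theorem vanishingIdeal_affineCone_zariskiClosure (b : Module.Basis ι ℂ W) (S : Set (ℙ ℂ W)) :
    vanishingIdeal ℂ (affineCone b (zariskiClosure b S)) = vanishingIdeal ℂ (affineCone b S) := by
  apply le_antisymm
  · apply vanishingIdeal_anti_mono
    rintro _ ⟨w, hw, hS, rfl⟩
    exact ⟨w, hw, subset_zariskiClosure b S hS, rfl⟩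
  · intro F hF
    rw [mem_vanishingIdeal_iff] at hF ⊢
    rintro _ ⟨w, hw, hS, rfl⟩
    rw [mk_mem_zariskiClosure_iff] at hS
    rw [← sum_homogeneousComponent F, map_sum]
    refine Finset.sum_eq_zero fun i _ => ?_
    exact hS i _ (homogeneousComponent_isHomogeneous i F) fun c hc =>
      eval_homogeneousComponent_eq_zero
        (fun a ha => by simpa using hF _ (smul_mem_affineCone hc ha)) i

theorem projDim_zariskiClosure (b : Module.Basis ι ℂ W) (S : Set (ℙ ℂ W)) :
    projDim b (zariskiClosure b S) = projDim b S := by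
  unfold projDim CoordinateRing
  rw [vanishingIdeal_affineCone_zariskiClosure]

end Cones

/-! ### Decomposable vectors -/

/-- The top exterior power of the common span is a line. -/
theorem exists_ιMulti_eq_smul {K M : Type*} [Field K] [AddCommGroup M] [Module K M] {k : ℕ}
    {e f : Fin k → M} (hf : LinearIndependent K f)
    (h : Submodule.span K (Set.range e) = Submodule.span K (Set.range f)) :
    ∃ c : K, exteriorPower.ιMulti K k e = c • exteriorPower.ιMulti K k f := by
  set E := Submodule.span K (Set.range f) with hE
  have he : ∀ q, e q ∈ E := fun q => h ▸ Submodule.subset_span ⟨q, rfl⟩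
  have hf' : ∀ q, f q ∈ E := fun q => Submodule.subset_span ⟨q, rfl⟩
  let e' : Fin k → E := fun q => ⟨e q, he q⟩
  let f' : Fin k → E := fun q => ⟨f q, hf' q⟩
  have hfi : LinearIndependent K f' := by
    apply LinearIndependent.of_comp E.subtype
    exact hf
  have hfin : Module.finrank K E = k := by
    rw [hE, finrank_span_eq_card hf, Fintype.card_fin]
  have : Module.Finite K E := by
    rw [hE]; exact Module.Finite.span_of_finite K (Set.finite_range f)
  have h1 : Module.finrank K (⋀[K]^k E) = 1 := by
    rw [exteriorPower.finrank_eq, hfin, Nat.choose_self]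
  have h2 : exteriorPower.ιMulti K k f' ≠ 0 := by
    have := (exteriorPower.ιMulti_family_linearIndependent_field k hfi).ne_zero
      (Set.powersetCard.ofFinEmbEquiv (RelEmbedding.refl _))
    simpa [exteriorPower.ιMulti_family] using this
  obtain ⟨c, hc⟩ := (finrank_eq_one_iff_of_nonzero' _ h2).1 h1 (exteriorPower.ιMulti K k e')
  refine ⟨c, ?_⟩
  have := congrArg (exteriorPower.map k E.subtype) hc
  rw [map_smul, exteriorPower.map_apply_ιMulti, exteriorPower.map_apply_ιMulti] at this
  exact this.symm

theorem ιMulti_ne_zero_iff {K M : Type*} [Field K] [AddCommGroup M] [Module K M] {k : ℕ}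
    {e : Fin k → M} : exteriorPower.ιMulti K k e ≠ 0 ↔ LinearIndependent K e := by
  constructor
  · intro h
    by_contra hc
    exact h (AlternatingMap.map_linearDependent _ _ hc)
  · intro he
    have := (exteriorPower.ιMulti_family_linearIndependent_field k he).ne_zero
      (Set.powersetCard.ofFinEmbEquiv (RelEmbedding.refl _))
    simpa [exteriorPower.ιMulti_family] using this

theorem exists_linearIndependent_sumElim {K M : Type*} [Field K] [AddCommGroup M] [Module K M]
    [Module.Finite K M] {r m : ℕ} (hM : Module.finrank K M = r + m) {a : Fin r → M}
    (ha : LinearIndependent K a) : ∃ b : Fin m → M, LinearIndependent K (Sum.elim a b) := by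
  obtain ⟨B, hB⟩ := Submodule.exists_isCompl (Submodule.span K (Set.range a))
  have h1 := Submodule.finrank_add_eq_of_isCompl hB
  rw [finrank_span_eq_card ha, Fintype.card_fin, hM] at h1
  let b := Module.finBasisOfFinrankEq K B (by omega : Module.finrank K B = m)
  refine ⟨fun i => b i, LinearIndependent.sum_type ha ?_ ?_⟩
  · exact b.linearIndependent.map' B.subtype (Submodule.ker_subtype B)
  · refine hB.disjoint.mono_right (Submodule.span_le.2 ?_)
    rintro _ ⟨i, rfl⟩
    exact (b i).2

/-! ### The parametrization of the restricted secant points -/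

/-- Indices of the vectors spanning `r`-restricted `s`-tuples of `(r + m)`-planes: `r` common
vectors, and `m` further ones for each plane. -/
abbrev RowIdx (r s m : ℕ) : Type := Fin r ⊕ (Fin s × Fin m)

/-- The `r + m` vectors spanning the `i`-th plane. -/
def rowSel {r s m : ℕ} (i : Fin s) (q : Fin (r + m)) : RowIdx r s m :=
  Sum.map id (Prod.mk i) (finSumFinEquiv.symm q)

theorem rowSel_injective {r s m : ℕ} (i : Fin s) :
    Function.Injective (rowSel (r := r) (m := m) i) :=
  (Sum.map_injective.2 ⟨Function.injective_id, Prod.mk_right_injective i⟩).comp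
    (Equiv.injective _)

theorem rowSel_castAdd {r s m : ℕ} (i : Fin s) (l : Fin r) :
    rowSel (m := m) i (Fin.castAdd m l) = Sum.inl l := by
  simp [rowSel]

theorem rowSel_natAdd {r s m : ℕ} (i : Fin s) (c : Fin m) :
    rowSel (r := r) i (Fin.natAdd r c) = Sum.inr (i, c) := by
  simp [rowSel]

/-- The Plücker coordinate `t` of `∑ λ_i Ê_i`, where `E_i` is spanned by the rows of `G` with
indices `rowSel i`. -/
def plucker {R J : Type*} [CommRing R] {r s m : ℕ} (lam : Fin s → R) (G : RowIdx r s m → J → R)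
    (t : Fin (r + m) → J) : R :=
  ∑ i, lam i * (Matrix.of fun q q' => G (rowSel i q) (t q')).det

/-- The vector `∑ λ_i Ê_i`, where `E_i` is spanned by the rows of `G` with indices `rowSel i`. -/
def secantVector {M : Type*} [AddCommGroup M] [Module ℂ M] {r s m : ℕ} (lam : Fin s → ℂ)
    (G : RowIdx r s m → M) : ⋀[ℂ]^(r + m) M :=
  ∑ i, lam i • exteriorPower.ιMulti ℂ (r + m) fun q => G (rowSel i q)

theorem pluckerBasis_repr_secantVector {n r s m : ℕ} (lam : Fin s → ℂ)
    (G : RowIdx r s m → V n) (S : Set.powersetCard (Fin n) (r + m)) :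
    (pluckerBasis (r + m) n).repr (secantVector lam G) S =
      plucker lam G (Set.powersetCard.ofFinEmbEquiv.symm S) := by
  rw [pluckerBasis, exteriorPower.basis_repr_apply]
  simp only [secantVector, plucker, map_sum, map_smul, exteriorPower.ιMultiDual_apply_ιMulti,
    Pi.basisFun_repr, Module.Basis.coord_apply, smul_eq_mul]

theorem map_secantVector {M M' : Type*} [AddCommGroup M] [Module ℂ M] [AddCommGroup M']
    [Module ℂ M'] {r s m : ℕ} (L : M →ₗ[ℂ] M') (lam : Fin s → ℂ) (G : RowIdx r s m → M) :
    exteriorPower.map (r + m) L (secantVector lam G) = secantVector lam fun i => L (G i) := by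
  simp [secantVector, exteriorPower.map_apply_ιMulti, Function.comp_def]

theorem smul_secantVector {M : Type*} [AddCommGroup M] [Module ℂ M] {r s m : ℕ}
    (a : ℂ) (lam : Fin s → ℂ) (G : RowIdx r s m → M) :
    a • secantVector lam G = secantVector (a • lam) G := by
  simp [secantVector, Finset.smul_sum, smul_smul]

theorem mk_secantVector_mem {n r s m : ℕ} (lam : Fin s → ℂ) (G : RowIdx r s m → V n)
    (h : secantVector lam G ≠ 0) :
    Projectivization.mk ℂ _ h ∈ restrictedSecantPoints (r + m) r s n := by
  classical
  obtain ⟨i₀, -, hi₀⟩ := Finset.exists_ne_zero_of_sum_ne_zero h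
  have hG₀ : LinearIndependent ℂ fun q => G (rowSel i₀ q) :=
    ιMulti_ne_zero_iff.1 (right_ne_zero_of_smul hi₀)
  -- Dependent rows contribute zero to the sum, but they do not span a k-plane. Such a plane is
  -- replaced by the plane `i₀`, with coefficient 0, which still contains the common vectors.
  let e : Fin s → Fin (r + m) → V n := fun i =>
    if LinearIndependent ℂ (fun q => G (rowSel i q)) then fun q => G (rowSel i q)
    else fun q => G (rowSel i₀ q)
  let c : Fin s → ℂ := fun i =>
    if LinearIndependent ℂ (fun q => G (rowSel i q)) then lam i else 0
  have he : ∀ i, LinearIndependent ℂ (e i) := by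
    intro i
    by_cases hi : LinearIndependent ℂ (fun q => G (rowSel i q))
    · simpa only [e, if_pos hi] using hi
    · simpa only [e, if_neg hi] using hG₀
  have hsum : secantVector lam G = ∑ i, c i • exteriorPower.ιMulti ℂ (r + m) (e i) := by
    refine Finset.sum_congr rfl fun i _ => ?_
    by_cases hi : LinearIndependent ℂ (fun q => G (rowSel i q))
    · simp only [e, c, if_pos hi]
    · simp only [c, if_neg hi, zero_smul]
      rw [AlternatingMap.map_linearDependent _ _ hi, smul_zero]
  refine ⟨fun i => Submodule.span ℂ (Set.range (e i)),
    fun i => exteriorPower.ιMulti ℂ (r + m) (e i), c, hsum ▸ h,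
    fun i => ⟨e i, he i, rfl, rfl⟩, ?_, ?_⟩
  · have ha : LinearIndependent ℂ fun l : Fin r => G (Sum.inl l) := by
      have := hG₀.comp (Fin.castAdd m) (Fin.castAdd_injective r m)
      simpa [Function.comp_def, rowSel_castAdd] using this
    have hle : Submodule.span ℂ (Set.range fun l : Fin r => G (Sum.inl l)) ≤
        ⨅ i, Submodule.span ℂ (Set.range (e i)) := by
      refine le_iInf fun i => Submodule.span_le.2 ?_
      rintro _ ⟨l, rfl⟩
      apply Submodule.subset_span
      refine ⟨Fin.castAdd m l, ?_⟩
      by_cases hi : LinearIndependent ℂ (fun q => G (rowSel i q))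
      · simp only [e, if_pos hi, rowSel_castAdd]
      · simp only [e, if_neg hi, rowSel_castAdd]
    have := Submodule.finrank_mono hle
    rwa [finrank_span_eq_card ha, Fintype.card_fin] at this
  · congr 1

theorem exists_secantVector_of_mem {n r s m : ℕ} {w : ⋀[ℂ]^(r + m) (V n)} {hw : w ≠ 0}
    (h : Projectivization.mk ℂ w hw ∈ restrictedSecantPoints (r + m) r s n) :
    ∃ (lam : Fin s → ℂ) (G : RowIdx r s m → V n), w = secantVector lam G := by
  obtain ⟨E, ω, c, hne, hE, hr, hx⟩ := h
  suffices H : ∃ (lam : Fin s → ℂ) (G : RowIdx r s m → V n),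
      ∑ i, c i • ω i = secantVector lam G by
    obtain ⟨lam, G, hG⟩ := H
    obtain ⟨a, ha⟩ := (Projectivization.mk_eq_mk_iff' ℂ _ _ hw hne).1 hx
    exact ⟨a • lam, G, by rw [← ha, hG, smul_secantVector]⟩
  -- Take r independent vectors of the intersection and complete them to a basis of each plane;
  -- changing the basis only rescales the Plücker vector, which is absorbed in the coefficient.
  obtain ⟨a, ha⟩ := exists_linearIndependent_of_le_finrank hr
  have haE : ∀ l i, (a l : V n) ∈ E i := fun l i => (Submodule.mem_iInf _).1 (a l).2 i
  have haV : LinearIndependent ℂ fun l => (a l : V n) :=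
    ha.map' (Submodule.subtype _) (Submodule.ker_subtype _)
  have key : ∀ i, ∃ (b : Fin m → V n) (c' : ℂ),
      ω i = c' • exteriorPower.ιMulti ℂ (r + m)
        (fun q => Sum.elim (fun l => (a l : V n)) b (finSumFinEquiv.symm q)) := by
    intro i
    obtain ⟨e, he, hspan, hω⟩ := hE i
    have hfin : Module.finrank ℂ (E i) = r + m := by
      rw [← hspan, finrank_span_eq_card he, Fintype.card_fin]
    have haEi : LinearIndependent ℂ fun l => (⟨a l, haE l i⟩ : E i) :=
      LinearIndependent.of_comp (E i).subtype haV
    obtain ⟨b, hb⟩ := exists_linearIndependent_sumElim hfin haEi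
    have hb' : LinearIndependent ℂ (Sum.elim (fun l => (a l : V n)) fun j => (b j : V n)) := by
      have hcomp : Sum.elim (fun l => (a l : V n)) (fun j => (b j : V n)) =
          (E i).subtype ∘ Sum.elim (fun l => ⟨a l, haE l i⟩) b := by
        ext x : 1
        rcases x with x | x <;> rfl
      rw [hcomp]
      exact hb.map' (E i).subtype (Submodule.ker_subtype _)
    have hb'' := hb'.comp _ (finSumFinEquiv (m := r) (n := m)).symm.injective
    have hle : Submodule.span ℂ (Set.range ((Sum.elim (fun l => (a l : V n))
        fun j => (b j : V n)) ∘ (finSumFinEquiv (m := r) (n := m)).symm)) ≤ E i := by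
      refine Submodule.span_le.2 ?_
      rintro _ ⟨q, rfl⟩
      rcases h : (finSumFinEquiv (m := r) (n := m)).symm q with x | x
      · simpa [h] using haE x i
      · simp [h]
    have heq := Submodule.eq_of_le_of_finrank_eq hle (by
      rw [finrank_span_eq_card hb'', Fintype.card_fin, hfin])
    obtain ⟨c', hc'⟩ := exists_ιMulti_eq_smul hb'' (hspan.trans heq.symm)
    exact ⟨fun j => b j, c', hω.trans hc'⟩
  choose b c' hbc using key
  refine ⟨fun i => c i * c' i, Sum.elim (fun l => (a l : V n)) fun p => b p.1 p.2, ?_⟩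
  refine Finset.sum_congr rfl fun i _ => ?_
  rw [hbc i, smul_smul]
  congr 2
  ext q : 1
  rcases h : (finSumFinEquiv (m := r) (n := m)).symm q with x | x <;> simp [rowSel, h]

theorem mem_affineCone_restrictedSecantPoints_iff {n r s m : ℕ}
    {c : Set.powersetCard (Fin n) (r + m) → ℂ} :
    c ∈ affineCone (pluckerBasis (r + m) n) (restrictedSecantPoints (r + m) r s n) ↔
      ∃ (lam : Fin s → ℂ) (G : RowIdx r s m → V n), secantVector lam G ≠ 0 ∧
        c = (pluckerBasis (r + m) n).repr (secantVector lam G) := by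
  constructor
  · rintro ⟨w, hw, h, rfl⟩
    obtain ⟨lam, G, rfl⟩ := exists_secantVector_of_mem h
    exact ⟨lam, G, hw, rfl⟩
  · rintro ⟨lam, G, h, rfl⟩
    exact ⟨_, h, mk_secantVector_mem lam G h, rfl⟩

/-- Linear maps carry restricted secant varieties into restricted secant varieties. -/
theorem mk_map_mem_restrictedSecant {r s m a b : ℕ} (L : V a →ₗ[ℂ] V b)
    {w : ⋀[ℂ]^(r + m) (V a)} {hw : w ≠ 0}
    (h : Projectivization.mk ℂ w hw ∈ restrictedSecant (r + m) r s a)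
    (hL : exteriorPower.map (r + m) L w ≠ 0) :
    Projectivization.mk ℂ _ hL ∈ restrictedSecant (r + m) r s b := by
  classical
  set β := pluckerBasis (r + m) a
  set β' := pluckerBasis (r + m) b
  set Λ := exteriorPower.map (r + m) L
  rw [restrictedSecant, mk_mem_zariskiClosure_iff] at h ⊢
  intro d F hF hvan
  obtain ⟨S, hS⟩ : ∃ S, β'.repr (Λ w) S ≠ 0 := by
    by_contra! hc
    exact hL (β'.repr.map_eq_zero_iff.1 (Finsupp.ext hc))
  let ℓ : Set.powersetCard (Fin b) (r + m) → MvPolynomial (Set.powersetCard (Fin a) (r + m)) ℂ :=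
    fun S => ∑ T, MvPolynomial.C (β'.repr (Λ (β T)) S) * MvPolynomial.X T
  have hℓ : ∀ (F : MvPolynomial _ ℂ) (v : ⋀[ℂ]^(r + m) (V a)),
      MvPolynomial.eval (β.repr v) (MvPolynomial.aeval ℓ F) =
        MvPolynomial.eval (β'.repr (Λ v)) F := by
    intro F v
    have hcoord : ∀ S, MvPolynomial.eval (β.repr v) (ℓ S) = β'.repr (Λ v) S := by
      intro S
      conv_rhs => rw [← β.sum_repr v]
      simp only [ℓ, map_sum, map_mul, MvPolynomial.eval_C, MvPolynomial.eval_X, map_smul,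
        Finsupp.coe_finsetSum, Finset.sum_apply, Finsupp.smul_apply, smul_eq_mul]
      exact Finset.sum_congr rfl fun _ _ => mul_comm _ _
    have : (MvPolynomial.aeval (β.repr v)).comp (MvPolynomial.aeval ℓ) =
        MvPolynomial.aeval (R := ℂ) (β'.repr (Λ v)) := by
      apply MvPolynomial.algHom_ext
      intro S
      simpa using hcoord S
    have := congrArg (fun f => f F) this
    simpa only [AlgHom.comp_apply, MvPolynomial.coe_aeval_eq_eval, MvPolynomial.aeval_eq_eval]
      using this
  -- The factor `X S` makes the pullback vanish also where `L` kills the secant vector, which F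
  -- alone may fail to do in degree 0. It cancels at the end because the coordinate S of `Λ w` is
  -- nonzero.
  have hhom : (MvPolynomial.aeval ℓ (F * MvPolynomial.X S)).IsHomogeneous (1 * (d + 1)) :=
    (hF.mul (MvPolynomial.isHomogeneous_X _ _)).aeval _ fun S =>
      MvPolynomial.IsHomogeneous.sum _ _ _ fun T _ => MvPolynomial.isHomogeneous_C_mul_X _ _
  have := h _ _ hhom ?_
  · rw [hℓ, map_mul, MvPolynomial.eval_X] at this
    exact (mul_eq_zero.1 this).resolve_right hS
  · intro c hc
    obtain ⟨lam, G, -, rfl⟩ := mem_affineCone_restrictedSecantPoints_iff.1 hc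
    rw [hℓ, map_mul, MvPolynomial.eval_X, map_secantVector]
    by_cases h0 : secantVector lam (fun i => L (G i)) = 0
    · rw [h0]; simp
    · rw [hvan _ (mem_affineCone_restrictedSecantPoints_iff.2 ⟨lam, _, h0, rfl⟩), zero_mul]

/-! ### Contractions and the subspace supporting a form -/

section Contraction

variable {M M' : Type*} [AddCommGroup M] [Module ℂ M] [AddCommGroup M'] [Module ℂ M'] {k : ℕ}

/-- The pairing of `w ∈ ⋀ᵏ M` with `φ_1 ∧ ⋯ ∧ φ_k`. -/
def formPairing (w : ⋀[ℂ]^k M) (φ : Fin k → Module.Dual ℂ M) : ℂ :=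
  exteriorPower.alternatingMapToDual ℂ M k φ w

theorem formPairing_map (L : M →ₗ[ℂ] M') (w : ⋀[ℂ]^k M) (φ : Fin k → Module.Dual ℂ M') :
    formPairing (exteriorPower.map k L w) φ = formPairing w fun q => φ q ∘ₗ L := by
  have : (exteriorPower.alternatingMapToDual ℂ M' k φ) ∘ₗ exteriorPower.map k L =
      exteriorPower.alternatingMapToDual ℂ M k fun q => φ q ∘ₗ L := by
    apply exteriorPower.linearMap_ext
    ext v
    simp [exteriorPower.map_apply_ιMulti]
  exact LinearMap.congr_fun this w

theorem formPairing_secantVector {r s m : ℕ} (lam : Fin s → ℂ) (G : RowIdx r s m → M)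
    (φ : Fin (r + m) → Module.Dual ℂ M) : formPairing (secantVector lam G) φ =
      ∑ i, lam i * (Matrix.of fun q q' => φ q' (G (rowSel i q))).det := by
  simp [formPairing, secantVector]

/-- The contraction of `w ∈ ⋀ᵏ M` with linear forms on `M`, in coordinates: the contraction with
`f` has the coordinates `⟨φ_1 ∧ ⋯ ∧ f ∧ ⋯ ∧ φ_k, w⟩`. -/
def contraction (w : ⋀[ℂ]^k M) :
    Module.Dual ℂ M →ₗ[ℂ] ((Fin k → Module.Dual ℂ M) × Fin k → ℂ) :=
  LinearMap.pi fun c => (LinearMap.applyₗ w) ∘ₗ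
    (exteriorPower.alternatingMapToDual ℂ M k).toMultilinearMap.toLinearMap c.1 c.2

theorem contraction_apply (w : ⋀[ℂ]^k M) (f : Module.Dual ℂ M)
    (c : (Fin k → Module.Dual ℂ M) × Fin k) :
    contraction w f c = formPairing w (Function.update c.1 c.2 f) := rfl

theorem contraction_add (w w' : ⋀[ℂ]^k M) (f : Module.Dual ℂ M)
    (c : (Fin k → Module.Dual ℂ M) × Fin k) :
    contraction (w + w') f c = contraction w f c + contraction w' f c := by
  simp [contraction_apply, formPairing]

theorem contraction_smul (a : ℂ) (w : ⋀[ℂ]^k M) (f : Module.Dual ℂ M)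
    (c : (Fin k → Module.Dual ℂ M) × Fin k) :
    contraction (a • w) f c = a * contraction w f c := by
  simp [contraction_apply, formPairing]

theorem contraction_map_eq_zero (L : M →ₗ[ℂ] M') (w : ⋀[ℂ]^k M) {f : Module.Dual ℂ M'}
    (hf : f ∘ₗ L = 0) : contraction (exteriorPower.map k L w) f = 0 := by
  ext c
  rw [contraction_apply, formPairing_map, Pi.zero_apply]
  exact congrArg (fun g : Module.Dual ℂ _ => g w) (AlternatingMap.map_coord_zero _ c.2 (by simpa))

theorem contraction_secantVector_eq_zero {r s m : ℕ} (lam : Fin s → ℂ) (G : RowIdx r s m → M)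
    {f : Module.Dual ℂ M} (hf : ∀ i, f (G i) = 0) : contraction (secantVector lam G) f = 0 := by
  ext c
  rw [contraction_apply, formPairing_secantVector]
  refine Finset.sum_eq_zero fun i _ => ?_
  rw [Matrix.det_eq_zero_of_column_eq_zero c.2 (by simp [hf]), mul_zero]

end Contraction

/-- Row rank equals column rank, for a matrix with possibly infinitely many columns: a functional
vanishing on all columns would be a relation between the rows. -/
theorem exists_det_ne_zero_of_linearIndependent {K C : Type*} [Field K] {d : ℕ}
    {v : Fin d → C → K} (hv : LinearIndependent K v) :
    ∃ c : Fin d → C, (Matrix.of fun l l' => v l (c l')).det ≠ 0 := by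
  let col : C → Fin d → K := fun c l => v l c
  have htop : Submodule.span K (Set.range col) = ⊤ := by
    by_contra hne
    obtain ⟨f, hf, hf0⟩ := Submodule.exists_le_ker_of_lt_top _ (lt_top_iff_ne_top.2 hne)
    apply hf
    have hker : ∑ l, f (Pi.single l 1) • v l = 0 := by
      ext c
      have h1 : f (col c) = 0 := hf0 (Submodule.subset_span ⟨c, rfl⟩)
      rw [LinearMap.pi_apply_eq_sum_univ f (col c)] at h1
      simp only [Finset.sum_apply, Pi.smul_apply, smul_eq_mul, Pi.zero_apply]
      rw [← h1]
      refine Finset.sum_congr rfl fun l _ => ?_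
      rw [mul_comm, smul_eq_mul]
      congr 2
      ext j
      simp [Pi.single_apply, eq_comm]
    have := Fintype.linearIndependent_iff.1 hv _ hker
    apply LinearMap.pi_ext'
    intro l
    ext
    simpa using this l
  obtain ⟨g, hg, -, hgi⟩ := Submodule.exists_fun_fin_finrank_span_eq K (Set.range col)
  have hd : d = Module.finrank K (Submodule.span K (Set.range col)) := by
    rw [htop, finrank_top, Module.finrank_fin_fun]
  choose c hc using hg
  refine ⟨fun l => c (Fin.cast hd l), ?_⟩
  have : (Matrix.of fun l l' => v l (c (Fin.cast hd l'))).col = g ∘ Fin.cast hd := by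
    ext l' l
    simp [Matrix.col, ← hc, col]
  have hu := Matrix.linearIndependent_cols_iff_isUnit.1
    (this ▸ hgi.comp (Fin.cast hd) (Fin.cast_injective hd))
  exact ((Matrix.isUnit_iff_isUnit_det _).1 hu).ne_zero

/-- The rank of the contraction map is at most the number of spanning vectors, on the whole
restricted secant variety. -/
theorem finrank_range_contraction_le {r s m n : ℕ} {w : ⋀[ℂ]^(r + m) (V n)} {hw : w ≠ 0}
    (h : Projectivization.mk ℂ w hw ∈ restrictedSecant (r + m) r s n) :
    Module.finrank ℂ (LinearMap.range (contraction w)) ≤ r + s * m := by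
  by_contra! hlt
  set N := r + s * m
  obtain ⟨u, hu⟩ := exists_linearIndependent_of_le_finrank (Nat.succ_le_of_lt hlt)
  choose f hf using fun l => (u l).2
  have hv : LinearIndependent ℂ fun l => contraction w (f l) := by
    rw [show (fun l => contraction w (f l)) = (Submodule.subtype _) ∘ u from funext hf]
    exact hu.map' (Submodule.subtype _) (Submodule.ker_subtype _)
  obtain ⟨c, hc⟩ := exists_det_ne_zero_of_linearIndependent hv
  apply hc
  set β := pluckerBasis (r + m) n
  -- A minor of size N + 1 of the contraction map, as a homogeneous polynomial in the Plücker
  -- coordinates. It is nonzero at w but will be shown to vanish on all secant points.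
  let A : Matrix (Fin N.succ) (Fin N.succ) (MvPolynomial _ ℂ) := Matrix.of fun l l' =>
    ∑ S, MvPolynomial.C (contraction (β S) (f l) (c l')) * MvPolynomial.X S
  have hA : ∀ v : ⋀[ℂ]^(r + m) (V n), MvPolynomial.eval (β.repr v) A.det =
      (Matrix.of fun l l' => contraction v (f l) (c l')).det := by
    intro v
    rw [RingHom.map_det]
    congr 1
    ext l l'
    have hlin : contraction v (f l) (c l') =
        ∑ S, β.repr v S * contraction (β S) (f l) (c l') := by
      let Λ : ⋀[ℂ]^(r + m) (V n) →ₗ[ℂ] ℂ :=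
        { toFun := fun v => contraction v (f l) (c l')
          map_add' := fun v v' => contraction_add v v' _ _
          map_smul' := fun a v => contraction_smul a v _ _ }
      change Λ v = ∑ S, β.repr v S * Λ (β S)
      conv_lhs => rw [← β.sum_repr v]
      simp only [map_sum, map_smul, smul_eq_mul]
    rw [Matrix.of_apply, hlin]
    simp [A, mul_comm]
  have hhom : A.det.IsHomogeneous (N.succ) := by
    rw [Matrix.det_apply]
    refine MvPolynomial.IsHomogeneous.sum _ _ _ fun σ _ => ?_
    have hp : (∏ i, A (σ i) i).IsHomogeneous (∑ _i : Fin N.succ, 1) :=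
      MvPolynomial.IsHomogeneous.prod _ _ _ fun i _ =>
        MvPolynomial.IsHomogeneous.sum _ _ _ fun S _ => MvPolynomial.isHomogeneous_C_mul_X _ _
    rw [Finset.sum_const, Finset.card_univ, Fintype.card_fin, smul_eq_mul, mul_one] at hp
    rcases Int.units_eq_one_or (Equiv.Perm.sign σ) with h1 | h1
    · simpa [h1] using hp
    · simpa [h1] using hp.neg
  rw [restrictedSecant, mk_mem_zariskiClosure_iff] at h
  have := h _ _ hhom ?_
  · rwa [hA] at this
  · intro x hx
    obtain ⟨lam, G, -, rfl⟩ := mem_affineCone_restrictedSecantPoints_iff.1 hx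
    rw [hA]
    -- Some combination of N + 1 functionals kills the N spanning vectors, so it contracts the form
    -- to zero and gives a relation between the rows of the minor.
    obtain ⟨a, ha, ha0⟩ : ∃ a : Fin N.succ → ℂ, a ≠ 0 ∧ ∀ i, (∑ l, a l • f l) (G i) = 0 := by
      let T : (Fin N.succ → ℂ) →ₗ[ℂ] (RowIdx r s m → ℂ) :=
        LinearMap.pi fun i => ∑ l, (f l (G i)) • LinearMap.proj l
      have hT : LinearMap.ker T ≠ ⊥ := by
        apply LinearMap.ker_ne_bot_of_finrank_lt
        simp [N]
      obtain ⟨a, ha, ha0⟩ := Submodule.exists_mem_ne_zero_of_ne_bot hT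
      refine ⟨a, ha0, fun i => ?_⟩
      have := congrFun (LinearMap.mem_ker.1 ha) i
      simpa [T, mul_comm] using this
    apply Matrix.exists_vecMul_eq_zero_iff.1
    refine ⟨a, ha, ?_⟩
    ext l'
    have := congrFun (contraction_secantVector_eq_zero lam G ha0) (c l')
    simpa [Matrix.vecMul, dotProduct, map_sum] using this

theorem incl_apply {i e : ℕ} (v : V i) (l : Fin (i + e)) :
    incl (Nat.le_add_right i e) v l = Sum.elim v (fun _ => 0) (finSumFinEquiv.symm l) := by
  obtain ⟨x, rfl⟩ := finSumFinEquiv.surjective l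
  rw [Equiv.symm_apply_apply]
  rcases x with x | x
  · exact (Fin.castLE_injective (Nat.le_add_right i e)).extend_apply v 0 x
  · refine Function.extend_apply' v (0 : Fin (i + e) → ℂ) _ ?_
    rintro ⟨y, hy⟩
    have := congrArg Fin.val hy
    simp at this
    omega

/-- The projection of `V_{i+e}` onto `V_i`. -/
def proj (i e : ℕ) : V (i + e) →ₗ[ℂ] V i := LinearMap.funLeft ℂ ℂ (Fin.castAdd e)

/-- A form annihilated by the contraction with the last coordinate functions comes from the span of
the first basis vectors. -/
theorem map_incl_map_proj {k i e : ℕ} {u : ⋀[ℂ]^k (V (i + e))}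
    (h : ∀ l : Fin e, contraction u (LinearMap.proj (Fin.natAdd i l)) = 0) :
    exteriorPower.map k (incl (Nat.le_add_right i e)) (exteriorPower.map k (proj i e) u) = u := by
  rw [← LinearMap.comp_apply, ← exteriorPower.map_comp]
  apply (pluckerBasis k (i + e)).repr.injective
  ext S
  have hcoord : ∀ v : ⋀[ℂ]^k (V (i + e)), (pluckerBasis k (i + e)).repr v S = formPairing v
      fun q => LinearMap.proj (Set.powersetCard.ofFinEmbEquiv.symm S q) := by
    intro v
    rw [pluckerBasis, exteriorPower.basis_repr_apply]
    have hb : (Pi.basisFun ℂ (Fin (i + e))).coord =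
        fun l => (LinearMap.proj l : Module.Dual ℂ (V (i + e))) := by
      ext; simp
    simp only [exteriorPower.ιMultiDual, exteriorPower.ιMulti_family, exteriorPower.pairingDual,
      exteriorPower.alternatingMapLinearEquiv_apply_ιMulti, formPairing, hb]
    rfl
  rw [hcoord, hcoord, formPairing_map]
  set t := Set.powersetCard.ofFinEmbEquiv.symm S
  by_cases ht : ∃ q l, t q = Fin.natAdd i l
  · obtain ⟨q, l, hq⟩ := ht
    have h1 := congrFun (h l) (fun q => LinearMap.proj (t q), q)
    rw [contraction_apply, ← hq] at h1
    simp only [Function.update_eq_self, Pi.zero_apply] at h1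
    rw [h1]
    refine congrArg (fun g : Module.Dual ℂ _ => g u) (AlternatingMap.map_coord_zero _ q ?_)
    refine LinearMap.ext fun v => ?_
    rw [hq]
    change incl _ _ (Fin.natAdd i l) = 0
    rw [incl_apply]
    simp
  · congr 1
    ext q : 1
    refine LinearMap.ext fun v => ?_
    obtain ⟨x, hx⟩ := finSumFinEquiv.surjective (t q)
    rcases x with x | x
    · change incl _ _ (t q) = v (t q)
      rw [incl_apply, ← hx, Equiv.symm_apply_apply]
      simp [proj, LinearMap.funLeft_apply]
    · exact absurd ⟨q, x, by rw [← hx]; simp⟩ ht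

/-- Independent functionals in K are completed to a basis of the dual space and used as the last
coordinates of a new coordinate system. -/
theorem exists_equiv_of_le_finrank {i e : ℕ} {K : Submodule ℂ (Module.Dual ℂ (V (i + e)))}
    (hK : e ≤ Module.finrank ℂ K) : ∃ h : V (i + e) ≃ₗ[ℂ] V (i + e),
      ∀ l : Fin e, (LinearMap.proj (Fin.natAdd i l) : Module.Dual ℂ (V (i + e))) ∘ₗ
        h.toLinearMap ∈ K := by
  obtain ⟨a, ha⟩ := exists_linearIndependent_of_le_finrank hK
  have haV := ha.map' (Submodule.subtype _) (Submodule.ker_subtype _)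
  obtain ⟨b, hb⟩ := exists_linearIndependent_sumElim (r := e) (m := i) (by
    rw [Subspace.dual_finrank_eq, Module.finrank_fin_fun, add_comm]) haV
  let φ : Fin (i + e) → Module.Dual ℂ (V (i + e)) := fun l =>
    Sum.elim b (K.subtype ∘ a) (finSumFinEquiv.symm l)
  let h : V (i + e) →ₗ[ℂ] V (i + e) := LinearMap.pi φ
  have hinj : Function.Injective h := by
    rw [← LinearMap.ker_eq_bot, LinearMap.ker_eq_bot']
    intro v hv
    have hv' : ∀ x, Sum.elim (K.subtype ∘ a) b x v = 0 := by
      intro x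
      have := congrFun hv (finSumFinEquiv x.swap)
      rcases x with x | x <;> simpa [h, φ] using this
    rw [← Module.forall_dual_apply_eq_zero_iff ℂ]
    intro f
    have hspan := hb.span_eq_top_of_card_eq_finrank' (by
      rw [Subspace.dual_finrank_eq, Module.finrank_fin_fun]
      simp [add_comm])
    have hf : f ∈ Submodule.span ℂ (Set.range (Sum.elim (K.subtype ∘ a) b)) :=
      hspan ▸ Submodule.mem_top
    induction hf using Submodule.span_induction with
    | mem x hx => obtain ⟨y, rfl⟩ := hx; exact hv' y
    | zero => simp
    | add x y _ _ hx hy => simp [hx, hy]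
    | smul c x _ hx => simp [hx]
  refine ⟨LinearEquiv.ofInjectiveEndo h hinj, fun l => ?_⟩
  have : (LinearMap.proj (Fin.natAdd i l) : Module.Dual ℂ (V (i + e))) ∘ₗ
      (LinearEquiv.ofInjectiveEndo h hinj).toLinearMap = a l := by
    refine LinearMap.ext fun v => ?_
    have : (finSumFinEquiv (m := i) (n := e)).symm (Fin.natAdd i l) = Sum.inr l := by simp
    change φ (Fin.natAdd i l) _ = _
    simp [φ, this]
  rw [this]
  exact (a l).2

theorem orbitStableAt (r s m : ℕ) : OrbitStableAt (r + m) r s (r + s * m) := by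
  intro i j hij hi
  obtain ⟨e, rfl⟩ := Nat.exists_eq_add_of_le hij
  apply Set.Subset.antisymm
  · rintro _ ⟨g, y, hy, rfl⟩
    induction y using Projectivization.ind with
    | h v hv =>
      rw [Projectivization.map_mk]
      exact mk_map_mem_restrictedSecant _ hy _
  · intro x hx
    induction x using Projectivization.ind with
    | h w hw =>
      have hrank := finrank_range_contraction_le hx
      have hadd := LinearMap.finrank_range_add_finrank_ker (contraction w)
      rw [Subspace.dual_finrank_eq, Module.finrank_fin_fun] at hadd
      obtain ⟨h, hh⟩ := exists_equiv_of_le_finrank (i := i) (e := e)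
        (K := LinearMap.ker (contraction w)) (by omega)
      set u := exteriorPower.map (r + m) h.toLinearMap w with hu
      have hu0 : ∀ l : Fin e, contraction u (LinearMap.proj (Fin.natAdd i l)) = 0 := by
        intro l
        ext c
        have h1 := congrFun (LinearMap.mem_ker.1 (hh l)) (fun q => c.1 q ∘ₗ h.toLinearMap, c.2)
        rw [contraction_apply, Pi.zero_apply] at h1
        rw [contraction_apply, Pi.zero_apply, hu, formPairing_map, ← h1]
        congr 1
        ext q : 1
        by_cases hq : q = c.2
        · subst hq; simp
        · simp [hq]
      have hsymm : exteriorPower.map (r + m) h.symm.toLinearMap u = w := by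
        rw [hu, ← LinearMap.comp_apply, ← exteriorPower.map_comp, LinearEquiv.comp_coe,
          LinearEquiv.self_trans_symm, LinearEquiv.refl_toLinearMap, exteriorPower.map_id]
        rfl
      have hy : exteriorPower.map (r + m) (proj i e ∘ₗ h.toLinearMap) w =
          exteriorPower.map (r + m) (proj i e) u := by
        rw [exteriorPower.map_comp]; rfl
      have hback : exteriorPower.map (r + m) (h.symm.toLinearMap ∘ₗ incl hij)
          (exteriorPower.map (r + m) (proj i e ∘ₗ h.toLinearMap) w) = w := by
        rw [exteriorPower.map_comp, LinearMap.comp_apply, hy, map_incl_map_proj hu0, hsymm]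
      have hy0 : exteriorPower.map (r + m) (proj i e ∘ₗ h.toLinearMap) w ≠ 0 := by
        intro h0
        rw [h0, map_zero] at hback
        exact hw hback.symm
      -- The preimage on V_i is a linear image of the given form, so it lies in the smaller variety.
      refine ⟨h.symm, Projectivization.mk ℂ _ hy0, mk_map_mem_restrictedSecant _ hx hy0, ?_⟩
      rw [Projectivization.map_mk]
      congr 1
      exact hback.symm

/-! ### The first step of orbit stability -/

theorem exists_rowSel_eq {r s m : ℕ} (hs : 1 ≤ s) (l : RowIdx r s m) :
    ∃ (i : Fin s) (q : Fin (r + m)), rowSel i q = l := by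
  rcases l with l | ⟨i, c⟩
  · exact ⟨⟨0, hs⟩, Fin.castAdd m l, rowSel_castAdd _ _⟩
  · exact ⟨i, Fin.natAdd r c, rowSel_natAdd _ _⟩

/-- The contraction of `∑ e_A ∧ e_{B_i}` with `x` has each coordinate of `x` among its
coordinates. -/
theorem sum_det_update_eq {R : Type*} [CommRing R] {r s m : ℕ} (hgen : s = 1 ∨ 2 ≤ m)
    (x : RowIdx r s m → R) (i : Fin s) (q : Fin (r + m)) :
    ∑ i', (Matrix.of fun q₁ q₂ => if q₂ = q then x (rowSel i' q₁) else
      if rowSel i' q₁ = rowSel i q₂ then 1 else 0).det = x (rowSel i q) := by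
  rw [Finset.sum_eq_single i]
  · have : (Matrix.of fun q₁ q₂ => if q₂ = q then x (rowSel i q₁) else
        if rowSel i q₁ = rowSel i q₂ then 1 else 0) =
        Matrix.updateCol (1 : Matrix (Fin (r + m)) (Fin (r + m)) R) q
          fun q₁ => x (rowSel i q₁) := by
      ext q₁ q₂
      simp [Matrix.updateCol_apply, Matrix.one_apply, (rowSel_injective i).eq_iff]
    rw [this, ← Matrix.cramer_apply, Matrix.cramer_one]
    rfl
  · intro i' _ hi'
    have hm : 2 ≤ m := by
      refine hgen.resolve_left ?_
      rintro rfl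
      exact hi' (Subsingleton.elim _ _)
    -- With m ≥ 2, a vector of plane i outside the common part survives the replacement at position
    -- q. It does not occur in plane i', so its column is zero.
    obtain ⟨c, hc⟩ : ∃ c : Fin m, Fin.natAdd r c ≠ q := by
      by_contra! hall
      have := (hall ⟨0, by omega⟩).trans (hall ⟨1, by omega⟩).symm
      simp [Fin.ext_iff] at this
    apply Matrix.det_eq_zero_of_column_eq_zero (Fin.natAdd r c)
    intro q₁
    rw [Matrix.of_apply, if_neg hc, if_neg]
    rw [rowSel_natAdd]
    intro h
    obtain ⟨y, rfl⟩ := finSumFinEquiv.surjective q₁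
    rcases y with y | y
    · simp [rowSel] at h
    · simp [rowSel] at h
      exact hi' h.1
  · simp

/-- The form in V_N built from N distinct basis vectors has injective contraction, whereas any
translate of a form on V_{N-1} is killed by a nonzero functional. -/
theorem not_orbitStableAt {r s m q : ℕ} (hs : 1 ≤ s) (hgen : s = 1 ∨ 2 ≤ m)
    (hq : q < r + s * m) : ¬ OrbitStableAt (r + m) r s q := by
  intro hstab
  set N := r + s * m with hN
  obtain ⟨i, hi⟩ : ∃ i, N = i + 1 := ⟨N - 1, by omega⟩
  let σ : RowIdx r s m ≃ Fin (i + 1) := Fintype.equivFinOfCardEq (by simp [← hi, hN])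
  let G : RowIdx r s m → V (i + 1) := fun l => Pi.single (σ l) 1
  have hker : ∀ f : Module.Dual ℂ (V (i + 1)), contraction (secantVector 1 G) f = 0 → f = 0 := by
    intro f hf
    apply LinearMap.pi_ext'
    intro l
    ext
    obtain ⟨l, rfl⟩ := σ.surjective l
    obtain ⟨a, p, rfl⟩ := exists_rowSel_eq hs l
    have h1 := congrFun hf (fun p' => LinearMap.proj (σ (rowSel a p')), p)
    rw [contraction_apply, formPairing_secantVector] at h1
    have h2 := sum_det_update_eq hgen (fun l => f (G l)) a p
    simp only [LinearMap.comp_apply, LinearMap.coe_single, LinearMap.zero_apply]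
    refine h2.symm.trans (Eq.trans ?_ h1)
    refine Finset.sum_congr rfl fun i' _ => ?_
    simp only [Pi.one_apply, one_mul]
    congr 1
    ext p₁ p₂
    by_cases hp : p₂ = p
    · subst hp; simp
    · simp [hp, G, Pi.single_apply, eq_comm (a := rowSel i' p₁)]
  have hne : secantVector 1 G ≠ 0 := by
    intro h0
    have := hker (LinearMap.proj (Fin.last i)) (by
      rw [h0]; ext; simp [contraction_apply, formPairing])
    have := LinearMap.congr_fun this (Pi.single (Fin.last i) 1)
    simp at this
  have hmem := subset_zariskiClosure (pluckerBasis _ _) _ (mk_secantVector_mem 1 G hne)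
  have h1 := hstab i (i + 1) (Nat.le_succ i) (by omega)
  rw [restrictedSecant, restrictedSecant] at h1
  rw [← h1] at hmem
  obtain ⟨g, y, -, hy⟩ := hmem
  induction y using Projectivization.ind with
  | h v hv =>
    rw [Projectivization.map_mk, Projectivization.mk_eq_mk_iff'] at hy
    obtain ⟨a, ha⟩ := hy
    -- The last coordinate composed with the inverse of g vanishes on the translate of V_i.
    have hf := hker ((LinearMap.proj (Fin.last i) : Module.Dual ℂ (V (i + 1))) ∘ₗ
      g.symm.toLinearMap) (by
        rw [← ha]
        ext c
        rw [contraction_smul, contraction_map_eq_zero]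
        · simp
        · refine LinearMap.ext fun x => ?_
          simp only [LinearMap.comp_apply, LinearEquiv.coe_coe, LinearEquiv.symm_apply_apply,
            LinearMap.proj_apply, LinearMap.zero_apply]
          rw [incl_apply (e := 1)]
          have : Fin.last i = Fin.natAdd i (0 : Fin 1) := by ext; simp
          rw [this]
          simp)
    have := LinearMap.congr_fun hf (g (Pi.single (Fin.last i) 1))
    simp at this

/-! ### Coordinate rings of parametrized varieties -/

/-- If the points of a `ℂ`-algebra `P` parametrize a dense subset of the affine cone over `S`
through `ψ`, then the dimension of the cone is the transcendence degree of the subalgebra generated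
by `ψ`. -/
theorem ringKrullDim_coordinateRing_of_parametrization {ι W P : Type} [AddCommGroup W] [Module ℂ W]
    [Finite ι] [CommRing P] [IsDomain P] [Algebra ℂ P] (b : Module.Basis ι ℂ W) (S : Set (ℙ ℂ W))
    (ψ : ι → P) (hsep : ∀ p : P, (∀ φ : P →ₐ[ℂ] ℂ, φ p = 0) → p = 0)
    (hcone : ∀ φ : P →ₐ[ℂ] ℂ, (fun i => φ (ψ i)) = 0 ∨ (fun i => φ (ψ i)) ∈ affineCone b S)
    (hdense : ∀ F : MvPolynomial ι ℂ, MvPolynomial.aeval ψ F = 0 →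
      ∀ c ∈ affineCone b S, MvPolynomial.eval c F = 0)
    (hne : ∃ i, ψ i ≠ 0) {d : ℕ} (hd : Algebra.trdeg ℂ (Algebra.adjoin ℂ (Set.range ψ)) = d) :
    ringKrullDim (CoordinateRing b S) = d := by
  have hker : MvPolynomial.vanishingIdeal ℂ (affineCone b S) =
      RingHom.ker (MvPolynomial.aeval (R := ℂ) ψ) := by
    ext F
    rw [MvPolynomial.mem_vanishingIdeal_iff, RingHom.mem_ker]
    simp only [MvPolynomial.aeval_eq_eval]
    refine ⟨fun h => ?_, hdense F⟩
    obtain ⟨i, hi⟩ := hne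
    -- Multiplying by a nonzero coordinate discards the parameters that map to the vertex of the
    -- cone.
    refine (mul_eq_zero.1 (hsep (ψ i * MvPolynomial.aeval ψ F) fun φ => ?_)).resolve_left hi
    have hφ : φ (MvPolynomial.aeval ψ F) = MvPolynomial.eval (fun i => φ (ψ i)) F := by
      rw [← MvPolynomial.aeval_eq_eval, ← AlgHom.comp_apply, MvPolynomial.comp_aeval]
    rw [map_mul, hφ]
    rcases hcone φ with h0 | h0
    · rw [congrFun h0 i]; simp
    · rw [h _ h0, mul_zero]
  rw [Algebra.adjoin_range_eq_range_aeval] at hd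
  unfold CoordinateRing
  rw [hker, ringKrullDim_eq_of_ringEquiv
    (Ideal.quotientKerEquivRange (MvPolynomial.aeval (R := ℂ) ψ)).toRingEquiv]
  have : Algebra.FiniteType ℂ (MvPolynomial.aeval (R := ℂ) ψ).range :=
    Algebra.FiniteType.of_surjective _ (AlgHom.rangeRestrict_surjective _)
  exact ringKrullDim_eq_trdeg hd

theorem map_plucker {R R' J : Type*} [CommRing R] [CommRing R'] {r s m : ℕ} (φ : R →+* R')
    (lam : Fin s → R) (G : RowIdx r s m → J → R) (t : Fin (r + m) → J) :
    φ (plucker lam G t) = plucker (fun i => φ (lam i)) (fun l j => φ (G l j)) t := by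
  simp only [plucker, map_sum, map_mul, RingHom.map_det]
  rfl

/-- The Plücker coordinate `t`, for an arbitrary sequence `t` of indices, is a linear combination of
those for the increasing sequences. -/
theorem exists_formPairing_eq_sum (k n : ℕ) (t : Fin k → Fin n) :
    ∃ a : Set.powersetCard (Fin n) k → ℂ, ∀ w : ⋀[ℂ]^k (V n),
      formPairing w (fun q => LinearMap.proj (t q)) = ∑ S, a S * (pluckerBasis k n).repr w S := by
  refine ⟨fun S => formPairing (pluckerBasis k n S) fun q => LinearMap.proj (t q), fun w => ?_⟩
  let Λ := exteriorPower.alternatingMapToDual ℂ (V n) k fun q => LinearMap.proj (t q)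
  change Λ w = ∑ S, Λ (pluckerBasis k n S) * (pluckerBasis k n).repr w S
  conv_lhs => rw [← (pluckerBasis k n).sum_repr w]
  simp only [map_sum, map_smul, smul_eq_mul, mul_comm]

theorem formPairing_proj_secantVector {n r s m : ℕ} (lam : Fin s → ℂ) (G : RowIdx r s m → V n)
    (t : Fin (r + m) → Fin n) :
    formPairing (secantVector lam G) (fun q => LinearMap.proj (t q)) = plucker lam G t := by
  rw [formPairing_secantVector]
  rfl

/-- The subalgebra generated by the Plücker coordinates. -/
def pluckerAlgebra {R J : Type*} [CommRing R] [Algebra ℂ R] {r s m : ℕ} (lam : Fin s → R)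
    (G : RowIdx r s m → J → R) : Subalgebra ℂ R :=
  Algebra.adjoin ℂ (Set.range (plucker lam G))

theorem plucker_mem_pluckerAlgebra {R J : Type*} [CommRing R] [Algebra ℂ R] {r s m : ℕ}
    (lam : Fin s → R) (G : RowIdx r s m → J → R) (t : Fin (r + m) → J) :
    plucker lam G t ∈ pluckerAlgebra lam G :=
  Algebra.subset_adjoin ⟨t, rfl⟩

/-- A parametrization with ring P need only reach the secant vectors off the hypersurface g = 0 of
the space of all coefficients and spanning vectors. It is used for graphs and for the affine chart.
-/
theorem ringKrullDim_restrictedSecantPoints {n r s m : ℕ} {P J : Type} [CommRing P] [IsDomain P]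
    [Algebra ℂ P] (hsep : ∀ p : P, (∀ φ : P →ₐ[ℂ] ℂ, φ p = 0) → p = 0) (e : J ≃ Fin n)
    (lam : Fin s → P) (G : RowIdx r s m → J → P) (hne : ∃ t, plucker lam G t ≠ 0)
    {g : MvPolynomial (Fin s ⊕ RowIdx r s m × J) ℂ} (hg : g ≠ 0)
    (hdense : ∀ (lam' : Fin s → ℂ) (G' : RowIdx r s m → J → ℂ),
      MvPolynomial.eval (Sum.elim lam' fun p => G' p.1 p.2) g ≠ 0 →
      ∃ φ : P →ₐ[ℂ] ℂ, ∀ t, plucker lam' G' t = φ (plucker lam G t))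
    {d : ℕ} (hd : Algebra.trdeg ℂ (pluckerAlgebra lam G) = d) :
    ringKrullDim (CoordinateRing (pluckerBasis (r + m) n)
      (restrictedSecantPoints (r + m) r s n)) = d := by
  let tS : Set.powersetCard (Fin n) (r + m) → Fin (r + m) → Fin n := fun S =>
    Set.powersetCard.ofFinEmbEquiv.symm S
  let ψ : Set.powersetCard (Fin n) (r + m) → P := fun S => plucker lam G fun q => e.symm (tS S q)
  have hφψ : ∀ (φ : P →ₐ[ℂ] ℂ), (fun S => φ (ψ S)) = (pluckerBasis (r + m) n).repr
      (secantVector (fun i => φ (lam i)) fun l j => φ (G l (e.symm j))) := by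
    intro φ
    ext S
    rw [pluckerBasis_repr_secantVector]
    exact map_plucker (φ : P →+* ℂ) _ _ _
  have hψ : ∀ t, ∃ a : Set.powersetCard (Fin n) (r + m) → ℂ,
      plucker lam G t = ∑ S, a S • ψ S := by
    intro t
    obtain ⟨a, ha⟩ := exists_formPairing_eq_sum (r + m) n fun q => e (t q)
    refine ⟨a, sub_eq_zero.1 (hsep _ fun φ => ?_)⟩
    have h1 := ha (secantVector (fun i => φ (lam i)) fun l j => φ (G l (e.symm j)))
    rw [formPairing_proj_secantVector, ← hφψ] at h1
    have h2 : φ (plucker lam G t) = plucker (fun i => φ (lam i))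
        (fun l j => φ (G l (e.symm j))) fun q => e (t q) := by
      have := map_plucker (φ : P →+* ℂ) lam G t
      simp only [plucker, Equiv.symm_apply_apply] at this ⊢
      exact this
    rw [map_sub, h2, h1]
    simp
  refine ringKrullDim_coordinateRing_of_parametrization _ _ ψ hsep ?_ ?_ ?_ ?_
  · intro φ
    rw [hφψ]
    by_cases h0 : secantVector (fun i => φ (lam i)) (fun l j => φ (G l (e.symm j))) = 0
    · left; rw [h0]; simp
    · right; exact mem_affineCone_restrictedSecantPoints_iff.2 ⟨_, _, h0, rfl⟩
  · intro F hF c hc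
    obtain ⟨lam', G', -, rfl⟩ := mem_affineCone_restrictedSecantPoints_iff.1 hc
    let Ψ : Set.powersetCard (Fin n) (r + m) → MvPolynomial (Fin s ⊕ RowIdx r s m × J) ℂ :=
      fun S => plucker (fun i => MvPolynomial.X (Sum.inl i))
        (fun l j => MvPolynomial.X (Sum.inr (l, j))) fun q => e.symm (tS S q)
    have hΨ : ∀ z S, MvPolynomial.eval z (Ψ S) = plucker (fun i => z (Sum.inl i))
        (fun l j => z (Sum.inr (l, j))) fun q => e.symm (tS S q) := by
      intro z S
      have := map_plucker (MvPolynomial.eval z) (fun i => MvPolynomial.X (Sum.inl i))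
        (fun l j => MvPolynomial.X (Sum.inr (l, j))) fun q => e.symm (tS S q)
      simpa using this
    have hev : ∀ z, MvPolynomial.eval z (MvPolynomial.aeval Ψ F) =
        MvPolynomial.eval (fun S => MvPolynomial.eval z (Ψ S)) F := by
      intro z
      rw [← MvPolynomial.aeval_eq_eval, ← MvPolynomial.aeval_eq_eval,
        ← AlgHom.comp_apply, MvPolynomial.comp_aeval]
    have h0 : MvPolynomial.aeval Ψ F = 0 := by
      -- The pullback of F vanishes off g = 0, hence identically, which also covers the special
      -- secant points.
      refine eq_zero_of_eval_eq_zero_of_ne hg fun z hz => ?_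
      obtain ⟨φ, hφ⟩ := hdense (fun i => z (Sum.inl i)) (fun l j => z (Sum.inr (l, j))) (by
        rwa [show (Sum.elim (fun i => z (Sum.inl i)) fun p => z (Sum.inr (p.1, p.2))) = z from
          funext fun x => by rcases x with x | x <;> rfl])
      rw [hev]
      simp only [hΨ, hφ]
      have : MvPolynomial.eval (fun S => φ (ψ S)) F = φ (MvPolynomial.aeval ψ F) := by
        rw [← MvPolynomial.aeval_eq_eval, ← AlgHom.comp_apply, MvPolynomial.comp_aeval]
      exact this.trans (by rw [hF, map_zero])
    have h1 := hev (Sum.elim lam' fun p => G' p.1 (e p.2))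
    rw [h0, map_zero] at h1
    rw [h1]
    congr 2
    ext S
    rw [hΨ, pluckerBasis_repr_secantVector]
    simp [plucker, tS]
  · by_contra! hall
    obtain ⟨t, ht⟩ := hne
    obtain ⟨a, ha⟩ := hψ t
    exact ht (by simp [ha, hall])
  · have : Algebra.adjoin ℂ (Set.range ψ) = pluckerAlgebra lam G := by
      apply le_antisymm
      · refine Algebra.adjoin_mono ?_
        rintro _ ⟨S, rfl⟩
        exact ⟨_, rfl⟩
      · refine Algebra.adjoin_le ?_
        rintro _ ⟨t, rfl⟩
        obtain ⟨a, ha⟩ := hψ t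
        rw [ha]
        exact sum_mem fun S _ =>
          Subalgebra.smul_mem _ (Algebra.subset_adjoin (Set.mem_range_self S)) _
    rwa [this]

/-! ### Forms on a variable subspace: the dimension of the bundle over the Grassmannian -/

theorem trdeg_eq_of_le_of_isAlgebraic {K P : Type*} [Field K] [CommRing P] [IsDomain P]
    [Algebra K P] {A B : Subalgebra K P} (hAB : A ≤ B) (h : ∀ b ∈ B, IsAlgebraic A b) :
    Algebra.trdeg K A = Algebra.trdeg K B := by
  let := (Subalgebra.inclusion hAB).toAlgebra
  have : IsScalarTower K A B := IsScalarTower.of_algebraMap_eq fun _ => rfl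
  have : IsScalarTower A B P := IsScalarTower.of_algebraMap_eq fun _ => rfl
  have hf : FaithfulSMul A B :=
    (faithfulSMul_iff_algebraMap_injective _ _).2 (Subalgebra.inclusion_injective hAB)
  have halg : Algebra.IsAlgebraic A B := ⟨fun b => by
    rw [← isAlgebraic_algHom_iff (IsScalarTower.toAlgHom A B P) Subtype.val_injective]
    exact h b b.2⟩
  have h0 : Algebra.trdeg A B = 0 := trdeg_eq_zero
  rw [← trdeg_add_eq K A (A := B), h0, add_zero]

/-- Linearity of the determinants in a single column. For a graph it gives linear equations for the
entries of the map, with Plücker coordinates as coefficients. -/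
theorem plucker_update_eq_sum {R J L : Type*} [CommRing R] [DecidableEq J] [Fintype L]
    {r s m : ℕ} (lam : Fin s → R) (G : RowIdx r s m → J → R) (t : Fin (r + m) → J)
    (q : Fin (r + m)) (j : J) (x : L → R) (c : L → J) (h : ∀ l, G l j = ∑ l', x l' * G l (c l')) :
    plucker lam G (Function.update t q j) =
      ∑ l', x l' * plucker lam G (Function.update t q (c l')) := by
  simp only [plucker, Finset.mul_sum]
  rw [Finset.sum_comm]
  refine Finset.sum_congr rfl fun i _ => ?_
  have hcol : ∀ j', (Matrix.of fun q₁ q₂ => G (rowSel i q₁) (Function.update t q j' q₂)).det =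
      (Matrix.of fun q₁ q₂ => G (rowSel i q₁) (t q₂)).cramer (fun q₁ => G (rowSel i q₁) j') q := by
    intro j'
    rw [Matrix.cramer_apply]
    congr 1
    ext q₁ q₂
    by_cases hq : q₂ = q
    · subst hq; simp
    · simp [hq]
  simp only [hcol]
  have hx : (fun q₁ => G (rowSel i q₁) j) =
      ∑ l', x l' • fun q₁ => G (rowSel i q₁) (c l') := by
    ext q₁
    simp [h]
  rw [hx, map_sum, Finset.sum_apply, Finset.mul_sum]
  refine Finset.sum_congr rfl fun l' _ => ?_
  rw [map_smul, Pi.smul_apply, smul_eq_mul]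
  ring

theorem plucker_eq_sum {R J L : Type*} [CommRing R] [Fintype L] [DecidableEq L] {r s m : ℕ}
    (lam : Fin s → R) (G : RowIdx r s m → J → R) (G₀ : RowIdx r s m → L → R) (y : L → J → R)
    (h : ∀ l j, G l j = ∑ l', y l' j * G₀ l l') (t : Fin (r + m) → J) :
    plucker lam G t = ∑ f : Fin (r + m) → L, (∏ q, y (f q) (t q)) * plucker lam G₀ f := by
  simp only [plucker, Finset.mul_sum]
  rw [Finset.sum_comm]
  refine Finset.sum_congr rfl fun i _ => ?_
  have h1 : (Matrix.of fun q q' => G (rowSel i q) (t q')).det = Matrix.detRowAlternating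
      fun q' => ∑ l', y l' (t q') • fun q => G₀ (rowSel i q) l' := by
    rw [← Matrix.det_transpose]
    change Matrix.det _ = Matrix.det _
    congr 1
    ext q' q
    simp [h]
  rw [h1]
  change lam i * Matrix.detRowAlternating.toMultilinearMap _ = _
  rw [MultilinearMap.map_sum, Finset.mul_sum]
  refine Finset.sum_congr rfl fun f _ => ?_
  rw [MultilinearMap.map_smul_univ, smul_eq_mul]
  have h2 : Matrix.detRowAlternating.toMultilinearMap (fun q' q => G₀ (rowSel i q) (f q')) =
      (Matrix.of fun q q' => G₀ (rowSel i q) (f q')).det := by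
    rw [← Matrix.det_transpose]
    rfl
  rw [h2]
  ring

section Graph

variable {R : Type} [CommRing R] {r s m e : ℕ}

/-- The coordinates in `V_{N+e}` of vectors on the graph of the generic linear map `V_N → V_e`. -/
def graphRow (e : ℕ) (G : RowIdx r s m → RowIdx r s m → R) (l : RowIdx r s m) :
    RowIdx r s m ⊕ Fin e → MvPolynomial (RowIdx r s m × Fin e) R :=
  Sum.elim (fun j => MvPolynomial.C (G l j))
    fun q => ∑ j, MvPolynomial.X (j, q) * MvPolynomial.C (G l j)

/-- The coefficients `λ_i` as constants in the polynomial ring of the graph coordinates. -/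
def graphLam (r m e : ℕ) (lam : Fin s → R) (i : Fin s) :
    MvPolynomial (RowIdx r s m × Fin e) R :=
  MvPolynomial.C (lam i)

theorem plucker_graph_inl (lam : Fin s → R) (G : RowIdx r s m → RowIdx r s m → R)
    (t : Fin (r + m) → RowIdx r s m) :
    plucker (graphLam r m e lam) (graphRow e G) (fun q => Sum.inl (t q)) =
      MvPolynomial.C (plucker lam G t) :=
  (map_plucker MvPolynomial.C lam G t).symm

/-- The Plücker algebra A of the graph lies in A₀[X], where A₀ is the algebra in V_N, and A₀[X] is
algebraic over A. Indeed A contains A₀, and the variables X solve a linear system over A whose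
determinant is nonzero, since φ specializes its matrix to the identity. -/
theorem trdeg_pluckerAlgebra_graph [IsDomain R] [Algebra ℂ R] (hs : 1 ≤ s)
    (hgen : s = 1 ∨ 2 ≤ m) (lam : Fin s → R) (G : RowIdx r s m → RowIdx r s m → R)
    (φ : R →+* ℂ) (hlam : ∀ i, φ (lam i) = 1) (hG : ∀ l j, φ (G l j) = if l = j then 1 else 0) :
    Algebra.trdeg ℂ (pluckerAlgebra (graphLam r m e lam) (graphRow e G)) =
      Algebra.trdeg ℂ (pluckerAlgebra lam G) + ((r + s * m) * e : ℕ) := by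
  set A₀ := pluckerAlgebra lam G
  set A := pluckerAlgebra (graphLam r m e lam) (graphRow e G)
  let ι : MvPolynomial (RowIdx r s m × Fin e) A₀ →ₐ[ℂ] MvPolynomial (RowIdx r s m × Fin e) R :=
    MvPolynomial.mapAlgHom A₀.val
  have hι : Function.Injective ι := MvPolynomial.map_injective _ Subtype.val_injective
  have hAι : A ≤ ι.range := by
    refine Algebra.adjoin_le ?_
    rintro _ ⟨t, rfl⟩
    rw [SetLike.mem_coe, plucker_eq_sum (graphLam r m e lam) (graphRow e G)
      (fun l j => MvPolynomial.C (G l j))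
      (fun l' => Sum.elim (fun j => if l' = j then 1 else 0) fun q => MvPolynomial.X (l', q))]
    · refine sum_mem fun f _ => mul_mem (prod_mem fun q _ => ?_) ?_
      · rcases t q with j | j
        · simp only [Sum.elim_inl]
          split_ifs
          · exact one_mem _
          · exact zero_mem _
        · exact ⟨MvPolynomial.X (f q, j), MvPolynomial.map_X _ _⟩
      · refine ⟨MvPolynomial.C ⟨plucker lam G f, plucker_mem_pluckerAlgebra lam G f⟩, ?_⟩
        exact (MvPolynomial.map_C _ _).trans (map_plucker MvPolynomial.C lam G f)
    · intro l j
      rcases j with j | j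
      · simp [graphRow]
      · simp [graphRow]
  have hC : ∀ a ∈ A₀, IsAlgebraic A (MvPolynomial.C a : MvPolynomial (RowIdx r s m × Fin e) R) := by
    intro a ha
    have h1 : (MvPolynomial.C a : MvPolynomial (RowIdx r s m × Fin e) R) ∈ A := by
      have h2 : A₀ ≤ A.comap (IsScalarTower.toAlgHom ℂ R
          (MvPolynomial (RowIdx r s m × Fin e) R)) := by
        refine Algebra.adjoin_le ?_
        rintro _ ⟨t, rfl⟩
        have := plucker_mem_pluckerAlgebra (graphLam r m e lam) (graphRow e G)
          fun q => Sum.inl (t q)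
        rwa [plucker_graph_inl] at this
      exact h2 ha
    exact isAlgebraic_algebraMap (⟨_, h1⟩ : A)
  choose i q hiq using exists_rowSel_eq (r := r) (m := m) hs
  -- Row l uses a plane containing the vector l and replaces l there by an arbitrary index.
  let U₀ : Matrix (RowIdx r s m) (RowIdx r s m) R := Matrix.of fun l l' =>
    plucker lam G (Function.update (rowSel (i l)) (q l) l')
  have hU₀ : U₀.det ≠ 0 := by
    intro h0
    have h1 := congrArg φ h0
    have h2 : φ.mapMatrix U₀ = 1 := by
      ext l l'
      rw [RingHom.mapMatrix_apply, Matrix.map_apply]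
      change φ (plucker lam G (Function.update (rowSel (i l)) (q l) l')) = _
      rw [map_plucker]
      simp only [plucker, hlam, hG, one_mul]
      have h3 := sum_det_update_eq hgen (fun j => if j = l' then (1 : ℂ) else 0) (i l) (q l)
      rw [hiq] at h3
      rw [Matrix.one_apply, ← h3]
      refine Finset.sum_congr rfl fun i' _ => ?_
      congr 1
      ext q₁ q₂
      by_cases hq : q₂ = q l
      · simp [hq]
      · simp [hq]
    rw [RingHom.map_det, h2, Matrix.det_one, map_zero] at h1
    exact one_ne_zero h1
  let UA : Matrix (RowIdx r s m) (RowIdx r s m) A := Matrix.of fun l l' =>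
    ⟨_, plucker_mem_pluckerAlgebra (graphLam r m e lam) (graphRow e G)
      fun p => Sum.inl (Function.update (rowSel (i l)) (q l) l' p)⟩
  let U := A.val.toRingHom.mapMatrix UA
  have hU : U = (MvPolynomial.C : R →+* MvPolynomial (RowIdx r s m × Fin e) R).mapMatrix U₀ := by
    ext1 l l'
    exact plucker_graph_inl lam G _
  have hUdet : U.det ≠ 0 := by
    rw [hU, ← RingHom.map_det]
    exact fun h0 => hU₀ (MvPolynomial.C_injective _ _ (h0.trans (map_zero _).symm))
  have hX : ∀ p, IsAlgebraic A (MvPolynomial.X p : MvPolynomial (RowIdx r s m × Fin e) R) := by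
    rintro ⟨j, c⟩
    let w : RowIdx r s m → A := fun l =>
      ⟨_, plucker_mem_pluckerAlgebra (graphLam r m e lam) (graphRow e G)
        (Function.update (fun p => Sum.inl (rowSel (i l) p)) (q l) (Sum.inr c))⟩
    have hw : U.mulVec (fun j => MvPolynomial.X (j, c)) = fun l => (w l).1 := by
      ext1 l
      have h1 := plucker_update_eq_sum (graphLam r m e lam) (graphRow e G)
        (fun p => Sum.inl (rowSel (i l) p)) (q l) (Sum.inr c)
        (fun j => MvPolynomial.X (j, c)) Sum.inl fun l => by simp [graphRow]
      simp only [w]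
      rw [h1]
      refine Finset.sum_congr rfl fun l' _ => ?_
      rw [mul_comm]
      congr 1
      change plucker _ _ _ = plucker _ _ _
      congr 1
      ext p : 1
      by_cases hp : p = q l
      · subst hp; simp
      · simp [hp]
    -- Cramer's rule without division: the product of the variable with det U lies in A.
    have h2 : U.det * MvPolynomial.X (j, c) = (UA.adjugate.mulVec w j).1 := by
      have h3 : (U.adjugate.mulVec (U.mulVec fun j => MvPolynomial.X (j, c))) j =
          U.det * MvPolynomial.X (j, c) := by
        rw [Matrix.mulVec_mulVec, Matrix.adjugate_mul, Matrix.smul_mulVec, Matrix.one_mulVec]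
        rfl
      rw [← h3, hw, ← RingHom.map_adjugate]
      exact (RingHom.map_mulVec A.val.toRingHom UA.adjugate w j).symm
    refine IsAlgebraic.of_mul (y := U.det) (mem_nonZeroDivisors_of_ne_zero hUdet) ?_ ?_
    · have : U.det = (UA.det).1 := (RingHom.map_det A.val.toRingHom UA).symm
      rw [this]
      exact isAlgebraic_algebraMap UA.det
    · rw [h2]
      exact isAlgebraic_algebraMap (UA.adjugate.mulVec w j)
  have halg : ∀ b ∈ ι.range, IsAlgebraic A b := by
    rintro _ ⟨p, rfl⟩
    rw [← Subalgebra.mem_algebraicClosure]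
    induction p using MvPolynomial.induction_on with
    | C a =>
      rw [Subalgebra.mem_algebraicClosure]
      have : ι (MvPolynomial.C a) = MvPolynomial.C a.1 := MvPolynomial.map_C _ _
      exact this ▸ hC a a.2
    | add p p' hp hp' => exact (map_add ι p p').symm ▸ add_mem hp hp'
    | mul_X p x hp =>
      have : ι (p * MvPolynomial.X x) = ι p * MvPolynomial.X x :=
        (map_mul ι _ _).trans (congrArg _ (MvPolynomial.map_X _ _))
      exact this ▸ mul_mem hp ((Subalgebra.mem_algebraicClosure _ _).2 (hX x))
  have : FaithfulSMul ℂ A₀ :=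
    (faithfulSMul_iff_algebraMap_injective _ _).2 (algebraMap ℂ A₀).injective
  rw [trdeg_eq_of_le_of_isAlgebraic hAι halg, ← (AlgEquiv.ofInjective ι hι).trdeg_eq,
    ← trdeg_add_eq ℂ A₀ (A := MvPolynomial (RowIdx r s m × Fin e) A₀),
    MvPolynomial.trdeg_of_isDomain]
  congr 1
  simp

end Graph

/-! ### Generic spanning vectors -/

section Generic

open MvPolynomial

/-- Independent variables for the coefficients `λ_i`. -/
def genLam (r s m : ℕ) (i : Fin s) : MvPolynomial (Fin s ⊕ RowIdx r s m × RowIdx r s m) ℂ :=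
  X (Sum.inl i)

/-- Independent variables for the coordinates of spanning vectors in `V_N`, `N = r + s m`. -/
def genRow (r s m : ℕ) (l j : RowIdx r s m) :
    MvPolynomial (Fin s ⊕ RowIdx r s m × RowIdx r s m) ℂ :=
  X (Sum.inr (l, j))

theorem eval_plucker_gen {r s m : ℕ} (z : Fin s ⊕ RowIdx r s m × RowIdx r s m → ℂ)
    (t : Fin (r + m) → RowIdx r s m) : eval z (plucker (genLam r s m) (genRow r s m) t) =
      plucker (fun i => z (Sum.inl i)) (fun l j => z (Sum.inr (l, j))) t := by
  simpa [genLam, genRow] using map_plucker (eval z) (genLam r s m) (genRow r s m) t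

theorem plucker_single_rowSel {R : Type*} [CommRing R] {r s m : ℕ} (i : Fin s) (τ : R) :
    plucker (Pi.single i τ) (fun l j : RowIdx r s m => if l = j then (1 : R) else 0)
      (rowSel i) = τ := by
  rw [plucker, Finset.sum_eq_single i]
  · have : (Matrix.of fun q q' : Fin (r + m) =>
        if rowSel i q = rowSel i q' then (1 : R) else 0) = 1 := by
      ext q q'
      simp [Matrix.one_apply, (rowSel_injective i).eq_iff]
    rw [this]
    simp
  · intro j _ hj
    simp [hj]
  · simp

/-- The bound d ≥ 1 keeps the subtraction of 1 in `projDim` from being truncated. It holds because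
one Plücker coordinate has a nonzero derivative in a coefficient λ. -/
theorem exists_trdeg_pluckerAlgebra_gen {r s m : ℕ} (hs : 1 ≤ s) :
    ∃ d : ℕ, 1 ≤ d ∧ Algebra.trdeg ℂ (pluckerAlgebra (genLam r s m) (genRow r s m)) = d := by
  have hft : Algebra.FiniteType ℂ (pluckerAlgebra (genLam r s m) (genRow r s m)) :=
    (Subalgebra.fg_iff_finiteType _).1 (⟨(Set.finite_range _).toFinset, by
      rw [Set.Finite.coe_toFinset]; rfl⟩)
  obtain ⟨d, hd⟩ := Cardinal.lt_aleph0.1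
    (trdeg_lt_aleph0_of_finiteType (R := ℂ)
      (S := pluckerAlgebra (genLam r s m) (genRow r s m)))
  refine ⟨d, ?_, hd⟩
  let i₀ : Fin s := ⟨0, hs⟩
  let A := pluckerAlgebra (genLam r s m) (genRow r s m)
  let P : Unit → A := fun _ =>
    ⟨plucker (genLam r s m) (genRow r s m) (rowSel i₀), plucker_mem_pluckerAlgebra _ _ _⟩
  have hP : AlgebraicIndependent ℂ (A.val ∘ P) := by
    refine algebraicIndependent_of_jacobian _ (fun _ => Sum.inl i₀)
      (Sum.elim 0 fun p => if p.1 = p.2 then 1 else 0) fun _ _ => ?_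
    rw [if_pos rfl]
    refine eval_pderiv_of_line (a := 0) fun τ => ?_
    change eval _ (plucker (genLam r s m) (genRow r s m) (rowSel i₀)) = _
    rw [eval_plucker_gen, zero_add, one_mul]
    refine Eq.trans ?_ (plucker_single_rowSel (r := r) (m := m) i₀ τ)
    congr 1
    · ext i
      by_cases hi : i = i₀
      · subst hi; simp
      · simp [hi]
    · ext l j
      simp
  have h1 := ((AlgHom.algebraicIndependent_iff A.val Subtype.val_injective).1
    hP).cardinalMk_le_trdeg
  rw [hd, Cardinal.mk_unit] at h1
  exact_mod_cast h1

/-- Evaluation of the polynomials in the coordinates of a graph. -/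
def graphEval {ξ τ : Type} (x : ξ → ℂ) (z : τ → ℂ) :
    MvPolynomial ξ (MvPolynomial τ ℂ) →ₐ[ℂ] ℂ :=
  (aeval x).comp (mapAlgHom (aeval z))

theorem graphEval_X {ξ τ : Type} (x : ξ → ℂ) (z : τ → ℂ) (j : ξ) : graphEval x z (X j) = x j := by
  simp [graphEval]

theorem graphEval_C {ξ τ : Type} (x : ξ → ℂ) (z : τ → ℂ) (p : MvPolynomial τ ℂ) :
    graphEval x z (C p) = eval z p := by
  simp [graphEval, aeval_eq_eval]

theorem eq_zero_of_forall_algHom {ξ τ : Type} {p : MvPolynomial ξ (MvPolynomial τ ℂ)}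
    (h : ∀ φ : MvPolynomial ξ (MvPolynomial τ ℂ) →ₐ[ℂ] ℂ, φ p = 0) : p = 0 := by
  have h1 : ∀ z : τ → ℂ, map (eval z) p = 0 := by
    intro z
    apply MvPolynomial.funext
    intro x
    have := h (graphEval x z)
    simpa [graphEval, aeval_eq_eval] using! this
  ext1 u
  apply MvPolynomial.funext
  intro z
  rw [coeff_zero, map_zero, ← coeff_map, h1, coeff_zero]

theorem ringKrullDim_restrictedSecantPoints_add {r s m d : ℕ} (hs : 1 ≤ s)
    (hgen : s = 1 ∨ 2 ≤ m)
    (hd : Algebra.trdeg ℂ (pluckerAlgebra (genLam r s m) (genRow r s m)) = d) (e : ℕ) :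
    ringKrullDim (CoordinateRing (pluckerBasis (r + m) (r + s * m + e))
      (restrictedSecantPoints (r + m) r s (r + s * m + e))) = (d + (r + s * m) * e : ℕ) := by
  let i₀ : Fin s := ⟨0, hs⟩
  let σ : RowIdx r s m ⊕ Fin e ≃ Fin (r + s * m + e) := Fintype.equivFinOfCardEq (by simp)
  let M : Matrix (RowIdx r s m) (RowIdx r s m)
      (MvPolynomial (Fin s ⊕ RowIdx r s m × (RowIdx r s m ⊕ Fin e)) ℂ) :=
    Matrix.of fun l j => X (Sum.inr (l, Sum.inl j))
  have hM : ∀ z, eval z M.det = (Matrix.of fun l j => z (Sum.inr (l, Sum.inl j))).det := by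
    intro z
    rw [RingHom.map_det]
    congr 1
    ext l j
    simp [M]
  refine ringKrullDim_restrictedSecantPoints (fun p hp => eq_zero_of_forall_algHom hp) σ
    (graphLam r m e (genLam r s m)) (graphRow e (genRow r s m)) ?_ (g := M.det) ?_ ?_ ?_
  · refine ⟨fun q => Sum.inl (rowSel i₀ q), fun h0 => ?_⟩
    rw [plucker_graph_inl] at h0
    have h1 := (C_injective _ _ (h0.trans (map_zero _).symm))
    have h2 := congrArg
      (eval (Sum.elim (Pi.single i₀ 1) fun p => if p.1 = p.2 then 1 else 0)) h1
    rw [eval_plucker_gen, map_zero] at h2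
    exact one_ne_zero ((plucker_single_rowSel (r := r) (m := m) i₀ (1 : ℂ)).symm.trans h2)
  · intro h0
    have h1 := hM (Sum.elim 0 fun p => if Sum.inl p.1 = p.2 then 1 else 0)
    rw [h0, map_zero] at h1
    have h2 : (Matrix.of fun l j : RowIdx r s m => Sum.elim (α := Fin s) (γ := ℂ) 0
        (fun p : RowIdx r s m × (RowIdx r s m ⊕ Fin e) => if Sum.inl p.1 = p.2 then 1 else 0)
        (Sum.inr (l, Sum.inl j))) = 1 := by
      ext l j
      simp [Matrix.one_apply]
    rw [h2, Matrix.det_one] at h1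
    exact zero_ne_one h1
  · intro lam' G' hz
    rw [hM] at hz
    let G₀ : Matrix (RowIdx r s m) (RowIdx r s m) ℂ := Matrix.of fun l j => G' l (Sum.inl j)
    let G₁ : Matrix (RowIdx r s m) (Fin e) ℂ := Matrix.of fun l q => G' l (Sum.inr q)
    have hG₀ : IsUnit G₀.det := isUnit_iff_ne_zero.2 hz
    -- Rows (G₀ | G₁) with G₀ invertible lie on the graph given by G₀⁻¹ G₁.
    let φ := graphEval (fun p : RowIdx r s m × Fin e => (G₀⁻¹ * G₁) p.1 p.2)
      (Sum.elim lam' fun p : RowIdx r s m × RowIdx r s m => G' p.1 (Sum.inl p.2))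
    refine ⟨φ, fun t => ?_⟩
    have h1 := map_plucker (φ : _ →+* ℂ) (graphLam r m e (genLam r s m))
      (graphRow e (genRow r s m)) t
    refine Eq.trans ?_ h1.symm
    congr 1
    · ext i
      simp [φ, graphLam, graphEval_C, genLam]
    · ext l j
      rcases j with j | q
      · simp [φ, graphRow, graphEval_C, genRow]
      · have h2 : (G₀ * (G₀⁻¹ * G₁)) l q = G' l (Sum.inr q) := by
          rw [Matrix.mul_nonsing_inv_cancel_left _ _ hG₀]
          rfl
        rw [← h2, Matrix.mul_apply]
        simp [φ, graphRow, graphEval_C, graphEval_X, genRow, G₀, mul_comm]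
  · rw [trdeg_pluckerAlgebra_graph hs hgen _ _
      (eval (Sum.elim 1 fun p => if p.1 = p.2 then 1 else 0)), hd]
    · push_cast; rfl
    · intro i; simp [genLam]
    · intro l j; simp [genRow]

end Generic

/-! ### An affine chart, and the dimension of the restricted secant variety -/

/-- Indices of the parameters of the chart: the coefficients of the forms, the coordinates of the
common `r`-plane, and those of the further vectors of the `s` planes. -/
abbrev ChartIdx (r s m : ℕ) : Type :=
  Fin s ⊕ (Fin r × (Fin s × Fin m)) ⊕ ((Fin m × Fin m) × {p : Fin s × Fin s // p.1 ≠ p.2})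

/-- The vectors with parameters `z` in the chart. -/
def chartRow {R : Type*} [CommRing R] {r s m : ℕ} (z : ChartIdx r s m → R) :
    RowIdx r s m → RowIdx r s m → R
  | Sum.inl a, Sum.inl a' => if a = a' then 1 else 0
  | Sum.inl a, Sum.inr b => z (Sum.inr (Sum.inl (a, b)))
  | Sum.inr _, Sum.inl _ => 0
  | Sum.inr p, Sum.inr p' => if h : p.1 = p'.1 then (if p.2 = p'.2 then 1 else 0) else
      z (Sum.inr (Sum.inr ((p.2, p'.2), ⟨(p.1, p'.1), h⟩)))

theorem map_chartRow {R R' : Type*} [CommRing R] [CommRing R'] {r s m : ℕ} (φ : R →+* R')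
    (z : ChartIdx r s m → R) (l j : RowIdx r s m) :
    φ (chartRow z l j) = chartRow (fun d => φ (z d)) l j := by
  rcases l with l | l <;> rcases j with j | j
  · simp only [chartRow]
    split_ifs <;> simp only [map_one, map_zero]
  · rfl
  · exact map_zero φ
  · simp only [chartRow]
    split_ifs <;> simp only [map_one, map_zero]

theorem card_chartIdx (r s m : ℕ) :
    Fintype.card (ChartIdx r s m) = s + (r * (s * m) + m * m * (s * s - s)) := by
  have h : Fintype.card {p : Fin s × Fin s // p.1 ≠ p.2} = s * s - s := by
    have := Finset.offDiag_card (Finset.univ : Finset (Fin s))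
    rw [Finset.card_univ, Fintype.card_fin] at this
    rw [← this, Fintype.card_subtype]
    congr 1
    ext p
    simp
  simp only [Fintype.card_sum, Fintype.card_prod, Fintype.card_fin, h]

theorem sum_elim_rowSel {r s m : ℕ} (i : Fin s) (u : Fin r ⊕ Fin m) :
    rowSel i (finSumFinEquiv u) = Sum.map id (Prod.mk i) u := by
  simp [rowSel]

/-- Generic vectors can be moved into the chart by row operations. -/
theorem exists_chart {r s m : ℕ} (lam : Fin s → ℂ) (G : RowIdx r s m → RowIdx r s m → ℂ)
    (hA : (Matrix.of fun a a' : Fin r => G (Sum.inl a) (Sum.inl a')).det ≠ 0)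
    (hC : ∀ i, (Matrix.of fun u v : Fin r ⊕ Fin m =>
      G (Sum.map id (Prod.mk i) u) (Sum.map id (Prod.mk i) v)).det ≠ 0) :
    ∃ z : ChartIdx r s m → ℂ, ∀ t, plucker lam G t =
      plucker (fun i => z (Sum.inl i)) (chartRow z) t := by
  let A : Matrix (Fin r) (Fin r) ℂ := Matrix.of fun a a' => G (Sum.inl a) (Sum.inl a')
  let C : Fin s → Matrix (Fin r ⊕ Fin m) (Fin r ⊕ Fin m) ℂ := fun i => Matrix.of fun u v =>
    G (Sum.map id (Prod.mk i) u) (Sum.map id (Prod.mk i) v)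
  let H : Fin s → Matrix (Fin r ⊕ Fin m) (RowIdx r s m) ℂ := fun i => Matrix.of fun u j =>
    G (Sum.map id (Prod.mk i) u) j
  -- Row operations on plane i. The first r rows use only A⁻¹, independent of i, so that the common
  -- vectors remain common. The change of the determinant is compensated by multiplying λ_i by det
  -- C_i.
  let L : Fin s → Matrix (Fin r ⊕ Fin m) (Fin r ⊕ Fin m) ℂ := fun i =>
    Matrix.of (Sum.elim (fun a => Sum.elim (A⁻¹ a) 0) fun c => (C i)⁻¹ (Sum.inr c))
  let z : ChartIdx r s m → ℂ := Sum.elim (fun i => lam i * (C i).det)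
    (Sum.elim (fun p => ∑ a', A⁻¹ p.1 a' * G (Sum.inl a') (Sum.inr p.2))
      fun p => ∑ u, (C p.2.1.1)⁻¹ (Sum.inr p.1.1) u *
        G (Sum.map id (Prod.mk p.2.1.1) u) (Sum.inr (p.2.1.2, p.1.2)))
  have hinvA : A⁻¹ * A = 1 := Matrix.nonsing_inv_mul _ (isUnit_iff_ne_zero.2 hA)
  have hinvC : ∀ i, (C i)⁻¹ * C i = 1 := fun i =>
    Matrix.nonsing_inv_mul _ (isUnit_iff_ne_zero.2 (hC i))
  have hLH : ∀ i u j, (L i * H i) u j = chartRow z (Sum.map id (Prod.mk i) u) j := by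
    intro i u j
    rw [Matrix.mul_apply]
    rcases u with a | c
    · rw [Fintype.sum_sum_type]
      rcases j with a' | b
      · have := congrFun (congrFun hinvA a) a'
        rw [Matrix.mul_apply, Matrix.one_apply] at this
        simpa [L, H, chartRow, A] using this
      · simp [L, H, chartRow, z]
    · rcases j with a' | ⟨j, d⟩
      · have := congrFun (congrFun (hinvC i) (Sum.inr c)) (Sum.inl a')
        rw [Matrix.mul_apply, Matrix.one_apply_ne (by simp)] at this
        exact this
      · by_cases hij : i = j
        · subst hij
          have := congrFun (congrFun (hinvC i) (Sum.inr c)) (Sum.inr d)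
          rw [Matrix.mul_apply, Matrix.one_apply] at this
          simpa [L, H, chartRow, C] using this
        · simp [L, H, chartRow, z, hij]
  have hdet : ∀ i, (C i).det * (L i).det = 1 := by
    intro i
    rw [mul_comm, ← Matrix.det_mul]
    have : L i * C i = Matrix.fromBlocks 1
        (Matrix.of fun a c => z (Sum.inr (Sum.inl (a, (i, c))))) 0 1 := by
      ext u v
      have h1 : (L i * C i) u v = (L i * H i) u (Sum.map id (Prod.mk i) v) := rfl
      rw [h1, hLH]
      rcases u with a | c <;> rcases v with a' | c' <;> simp [chartRow, Matrix.one_apply]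
    rw [this, Matrix.det_fromBlocks_zero₂₁, Matrix.det_one, Matrix.det_one, one_mul]
  have hre : ∀ (G' : RowIdx r s m → RowIdx r s m → ℂ) (i : Fin s)
      (t : Fin (r + m) → RowIdx r s m), (Matrix.of fun q q' => G' (rowSel i q) (t q')).det =
      (Matrix.of fun u v => G' (Sum.map id (Prod.mk i) u) (t (finSumFinEquiv v))).det := by
    intro G' i t
    rw [← Matrix.det_submatrix_equiv_self (finSumFinEquiv (m := r) (n := m))]
    congr 1
    ext u v
    simp [sum_elim_rowSel]
  refine ⟨z, fun t => Finset.sum_congr rfl fun i _ => ?_⟩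
  rw [hre, hre]
  have h2 : (Matrix.of fun u v => chartRow z (Sum.map id (Prod.mk i) u) (t (finSumFinEquiv v))) =
      L i * Matrix.of fun u v => G (Sum.map id (Prod.mk i) u) (t (finSumFinEquiv v)) := by
    ext u v
    rw [Matrix.of_apply, ← hLH]
    rfl
  rw [h2, Matrix.det_mul]
  change _ = lam i * (C i).det * _
  linear_combination -lam i * (Matrix.of fun u v =>
    G (Sum.map id (Prod.mk i) u) (t (finSumFinEquiv v))).det * hdet i

/-! #### Coincidence determinants -/

section Coincidence

variable {T : Type*} [DecidableEq T] {k : ℕ}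

/-- The coordinate `t` of `e_{ρ 1} ∧ ⋯ ∧ e_{ρ k}`. -/
def coincidence (ρ t : Fin k → T) : ℂ :=
  (Matrix.of fun q q' => if ρ q = t q' then (1 : ℂ) else 0).det

theorem coincidence_self {ρ : Fin k → T} (h : Function.Injective ρ) : coincidence ρ ρ = 1 := by
  rw [← Matrix.det_one (n := Fin k), coincidence]
  congr 1
  ext q q'
  simp [Matrix.one_apply, h.eq_iff]

/-- An index occurring in only one of the sequences gives a zero row or column. All vanishing
entries of the Jacobian matrix are detected this way. -/
theorem coincidence_eq_zero {ρ t : Fin k → T} {x : T}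
    (h : x ∈ Set.range ρ ∧ x ∉ Set.range t ∨ x ∈ Set.range t ∧ x ∉ Set.range ρ) :
    coincidence ρ t = 0 := by
  rcases h with ⟨⟨q, rfl⟩, hx⟩ | ⟨⟨q, rfl⟩, hx⟩
  · refine Matrix.det_eq_zero_of_row_eq_zero q fun q' => ?_
    rw [Matrix.of_apply, if_neg fun h => hx ⟨q', h.symm⟩]
  · refine Matrix.det_eq_zero_of_column_eq_zero q fun q' => ?_
    rw [Matrix.of_apply, if_neg fun h => hx ⟨q', h⟩]

theorem det_add_single {ρ : Fin k → T} (hρ : Function.Injective ρ) (t : Fin k → T) (q₀ : Fin k)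
    (y : T) (τ : ℂ) : (Matrix.of fun q q' => (if ρ q = t q' then (1 : ℂ) else 0) +
        if ρ q = ρ q₀ ∧ t q' = y then τ else 0).det =
      coincidence ρ t + coincidence (Function.update ρ q₀ y) t * τ := by
  set M : Matrix (Fin k) (Fin k) ℂ := Matrix.of fun q q' => if ρ q = t q' then (1 : ℂ) else 0
  have h1 : (Matrix.of fun q q' => (if ρ q = t q' then (1 : ℂ) else 0) +
      if ρ q = ρ q₀ ∧ t q' = y then τ else 0) = M.updateRow q₀
        (M q₀ + τ • fun q' => if y = t q' then 1 else 0) := by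
    ext q q'
    by_cases hq : q = q₀
    · subst hq
      simp [M, eq_comm (a := y)]
    · simp [M, hq, hρ.eq_iff]
  rw [h1, Matrix.det_updateRow_add, Matrix.updateRow_eq_self, Matrix.det_updateRow_smul,
    mul_comm τ]
  congr 2
  rw [coincidence]
  congr 1
  ext q q'
  by_cases hq : q = q₀
  · subst hq
    simp
  · simp [M, hq]

end Coincidence

theorem mem_range_rowSel_inl {r s m : ℕ} (i : Fin s) (a : Fin r) :
    (Sum.inl a : RowIdx r s m) ∈ Set.range (rowSel i) :=
  ⟨_, rowSel_castAdd i a⟩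

theorem mem_range_rowSel_inr {r s m : ℕ} (i : Fin s) (p : Fin s × Fin m) :
    (Sum.inr p : RowIdx r s m) ∈ Set.range (rowSel i) ↔ p.1 = i := by
  constructor
  · rintro ⟨q, hq⟩
    obtain ⟨u, rfl⟩ := finSumFinEquiv.surjective q
    rw [sum_elim_rowSel] at hq
    rcases u with u | u
    · simp at hq
    · simp at hq; rw [← hq]
  · rintro rfl
    exact ⟨_, rowSel_natAdd p.1 p.2⟩

theorem mem_range_update_iff {α β : Type*} [DecidableEq α] {f : α → β} (hf : Function.Injective f)
    (q : α) (y x : β) :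
    x ∈ Set.range (Function.update f q y) ↔ x = y ∨ (x ∈ Set.range f ∧ x ≠ f q) := by
  constructor
  · rintro ⟨q', rfl⟩
    by_cases hq : q' = q
    · subst hq; simp
    · right
      rw [Function.update_of_ne hq]
      exact ⟨⟨q', rfl⟩, fun h => hq (hf h)⟩
  · rintro (rfl | ⟨⟨q', rfl⟩, h⟩)
    · exact ⟨q, Function.update_self _ _ _⟩
    · exact ⟨q', Function.update_of_ne (fun h' => h (congrArg f h')) _ _⟩

theorem injective_update {α β : Type*} [DecidableEq α] {f : α → β} (hf : Function.Injective f)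
    {q : α} {y : β} (hy : y ∉ Set.range f) : Function.Injective (Function.update f q y) := by
  intro u v huv
  by_cases hu : u = q <;> by_cases hv : v = q
  · rw [hu, hv]
  · subst hu
    rw [Function.update_self, Function.update_of_ne hv] at huv
    exact absurd ⟨v, huv.symm⟩ hy
  · subst hv
    rw [Function.update_self, Function.update_of_ne hu] at huv
    exact absurd ⟨u, huv⟩ hy
  · rw [Function.update_of_ne hu, Function.update_of_ne hv] at huv
    exact hf huv

/-! ### The Jacobian matrix at the origin of the chart -/

/-- The point of the chart with `λ = 1` and all vectors standard basis vectors. -/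
def chartOrigin (r s m : ℕ) : ChartIdx r s m → ℂ := Sum.elim 1 0

theorem chartRow_add_single_inl {r s m : ℕ} (i : Fin s) (τ : ℂ) (l j : RowIdx r s m) :
    chartRow (chartOrigin r s m + Pi.single (Sum.inl i) τ) l j = if l = j then 1 else 0 := by
  rcases l with l | ⟨l, l'⟩ <;> rcases j with j | ⟨j, j'⟩ <;> simp [chartRow, chartOrigin]
  split_ifs <;> simp_all

theorem chartRow_add_single_inr_inl {r s m : ℕ} (a : Fin r) (b : Fin s × Fin m) (τ : ℂ)
    (l j : RowIdx r s m) :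
    chartRow (chartOrigin r s m + Pi.single (Sum.inr (Sum.inl (a, b))) τ) l j =
      (if l = j then 1 else 0) + if l = Sum.inl a ∧ j = Sum.inr b then τ else 0 := by
  rcases l with l | ⟨l, l'⟩ <;> rcases j with j | ⟨j, j'⟩ <;>
    simp [chartRow, chartOrigin, Pi.single_apply, Prod.ext_iff]
  split_ifs <;> simp_all

theorem chartRow_add_single_inr_inr {r s m : ℕ} (c d : Fin m) (p : {p : Fin s × Fin s // p.1 ≠ p.2})
    (τ : ℂ) (l j : RowIdx r s m) :
    chartRow (chartOrigin r s m + Pi.single (Sum.inr (Sum.inr ((c, d), p))) τ) l j =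
      (if l = j then 1 else 0) +
        if l = Sum.inr (p.1.1, c) ∧ j = Sum.inr (p.1.2, d) then τ else 0 := by
  obtain ⟨⟨i, i'⟩, hp⟩ := p
  rcases l with l | ⟨l, l'⟩ <;> rcases j with j | ⟨j, j'⟩ <;>
    simp [chartRow, chartOrigin, Pi.single_apply, Prod.ext_iff]
  grind

/-- The derivative of the Plücker coordinate `t` at the origin of the chart. -/
def chartDeriv {r s m : ℕ} (t : Fin (r + m) → RowIdx r s m) : ChartIdx r s m → ℂ
  | Sum.inl i => coincidence (rowSel i) t
  | Sum.inr (Sum.inl (a, b)) =>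
    ∑ i, coincidence (Function.update (rowSel i) (Fin.castAdd m a) (Sum.inr b)) t
  | Sum.inr (Sum.inr ((c, d), p)) =>
    coincidence (Function.update (rowSel p.1.1) (Fin.natAdd r c) (Sum.inr (p.1.2, d))) t

/-- Each parameter is a coefficient or a single entry of a single row, so the coordinate is affine
in it. An entry of a common vector acts through all planes, any other entry only through its own. -/
theorem plucker_chart_line {r s m : ℕ} (t : Fin (r + m) → RowIdx r s m) (d : ChartIdx r s m)
    (τ : ℂ) :
    plucker (fun i => (chartOrigin r s m + (Pi.single d τ : ChartIdx r s m → ℂ)) (Sum.inl i))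
      (chartRow (chartOrigin r s m + Pi.single d τ)) t =
      (∑ i, coincidence (rowSel i) t) + chartDeriv t d * τ := by
  rcases d with i' | ⟨a, b⟩ | ⟨⟨c, d⟩, p⟩
  · simp only [plucker, chartRow_add_single_inl, chartDeriv, Pi.add_apply, add_mul,
      Finset.sum_add_distrib]
    congr 1
    · simp [chartOrigin, coincidence]
    · rw [Finset.sum_eq_single i']
      · simp [coincidence, mul_comm]
      · intro i _ hi
        simp [hi]
      · simp
  · simp only [plucker, chartRow_add_single_inr_inl, chartDeriv, Finset.sum_mul,
      ← Finset.sum_add_distrib]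
    refine Finset.sum_congr rfl fun i _ => ?_
    rw [← det_add_single (rowSel_injective i), rowSel_castAdd]
    simp [chartOrigin]
  · simp only [plucker, chartRow_add_single_inr_inr, chartDeriv]
    rw [← Finset.add_sum_erase _ _ (Finset.mem_univ p.1.1),
      ← Finset.add_sum_erase _ _ (Finset.mem_univ p.1.1), add_right_comm]
    congr 1
    · rw [← det_add_single (rowSel_injective _), rowSel_natAdd]
      simp [chartOrigin]
    · refine Finset.sum_congr rfl fun i hi => ?_
      have hne : ∀ q, ¬ (rowSel i q = (Sum.inr (p.1.1, c) : RowIdx r s m)) := by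
        intro q hq
        exact Finset.ne_of_mem_erase hi ((mem_range_rowSel_inr i _).1 ⟨q, hq⟩).symm
      simp [chartOrigin, coincidence, hne]

/-- For each parameter of the chart, a Plücker coordinate with derivative `1` in this parameter and
`0` in all others at the origin. -/
def chartCoord {r s m : ℕ} (other : Fin s × Fin m → Fin s) :
    ChartIdx r s m → Fin (r + m) → RowIdx r s m
  | Sum.inl i => rowSel i
  | Sum.inr (Sum.inl (a, b)) =>
    Function.update (rowSel (other b)) (Fin.castAdd m a) (Sum.inr b)
  | Sum.inr (Sum.inr ((c, d), p)) =>
    Function.update (rowSel p.1.1) (Fin.natAdd r c) (Sum.inr (p.1.2, d))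

section Ranges

variable {r s m : ℕ}

theorem inl_mem_range_update_castAdd (i : Fin s) (a a' : Fin r) (b : Fin s × Fin m) :
    (Sum.inl a' : RowIdx r s m) ∈ Set.range
      (Function.update (rowSel i) (Fin.castAdd m a) (Sum.inr b)) ↔ a' ≠ a := by
  rw [mem_range_update_iff (rowSel_injective i), rowSel_castAdd]
  simp [mem_range_rowSel_inl i a']

theorem inr_mem_range_update_castAdd (i : Fin s) (a : Fin r) (b p : Fin s × Fin m) :
    (Sum.inr p : RowIdx r s m) ∈ Set.range
      (Function.update (rowSel i) (Fin.castAdd m a) (Sum.inr b)) ↔ p = b ∨ p.1 = i := by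
  rw [mem_range_update_iff (rowSel_injective i), rowSel_castAdd, mem_range_rowSel_inr]
  simp

theorem inl_mem_range_update_natAdd (i : Fin s) (c : Fin m) (a : Fin r) (b : Fin s × Fin m) :
    (Sum.inl a : RowIdx r s m) ∈ Set.range
      (Function.update (rowSel i) (Fin.natAdd r c) (Sum.inr b)) := by
  rw [mem_range_update_iff (rowSel_injective i), rowSel_natAdd]
  simp [mem_range_rowSel_inl i a]

theorem inr_mem_range_update_natAdd (i : Fin s) (c : Fin m) (b p : Fin s × Fin m) :
    (Sum.inr p : RowIdx r s m) ∈ Set.range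
      (Function.update (rowSel i) (Fin.natAdd r c) (Sum.inr b)) ↔
      p = b ∨ (p.1 = i ∧ p ≠ (i, c)) := by
  rw [mem_range_update_iff (rowSel_injective i), rowSel_natAdd, mem_range_rowSel_inr]
  simp

end Ranges

theorem exists_ne_ne_of_three_le {m : ℕ} (hm : 3 ≤ m) (c d : Fin m) : ∃ x, x ≠ c ∧ x ≠ d := by
  by_contra! h
  have hsub : (Finset.univ : Finset (Fin m)) ⊆ {c, d} := fun x _ => by
    by_cases hx : x = c
    · simp [hx]
    · simp [h x hx]
  have h1 := Finset.card_le_card hsub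
  have h2 := Finset.card_le_two (a := c) (b := d)
  rw [Finset.card_univ, Fintype.card_fin] at h1
  omega

/-- Each index set arises from that of a plane by exchanging at most one element. Index sets of
different planes differ in m elements on each side, so for m ≥ 3 the modified sets remain different.
The choice of `other` makes the exchange with a common vector bring in a new element; for s = 1 it
forces m = 0. -/
theorem chartDeriv_chartCoord {r s m : ℕ} (hm : 3 ≤ m ∨ s = 1) {other : Fin s × Fin m → Fin s}
    (hother : ∀ b, other b ≠ b.1) (d d' : ChartIdx r s m) :
    chartDeriv (chartCoord other d) d' = if d = d' then 1 else 0 := by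
  have h3 : ∀ i i' : Fin s, i ≠ i' → 3 ≤ m := by
    intro i i' h
    refine hm.resolve_right ?_
    rintro rfl
    exact h (Subsingleton.elim _ _)
  rcases d with i | ⟨a, b⟩ | ⟨⟨c, d⟩, ⟨⟨i, j⟩, hij⟩⟩ <;>
    rcases d' with i' | ⟨a', b'⟩ | ⟨⟨c', d'⟩, ⟨⟨i', j'⟩, hij'⟩⟩ <;>
    simp only [chartDeriv, chartCoord]
  · by_cases h : i = i'
    · subst h
      rw [coincidence_self (rowSel_injective i), if_pos rfl]
    · rw [if_neg (by simpa using h)]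
      refine coincidence_eq_zero (x := Sum.inr (i, ⟨0, by have := h3 _ _ h; omega⟩)) ?_
      simp only [mem_range_rowSel_inr]
      tauto
  · rw [if_neg (by simp)]
    refine Finset.sum_eq_zero fun i'' _ => coincidence_eq_zero (x := Sum.inl a') ?_
    simp only [inl_mem_range_update_castAdd, mem_range_rowSel_inl]
    tauto
  · rw [if_neg (by simp)]
    simp only at hij'
    obtain ⟨c'', hc'', -⟩ := exists_ne_ne_of_three_le (h3 _ _ hij') c' c'
    by_cases h : i = i'
    · subst h
      refine coincidence_eq_zero (x := Sum.inr (j', d')) ?_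
      simp only [mem_range_rowSel_inr, inr_mem_range_update_natAdd]
      tauto
    · refine coincidence_eq_zero (x := Sum.inr (i', c'')) ?_
      simp only [mem_range_rowSel_inr, inr_mem_range_update_natAdd, Prod.mk.injEq, ne_eq]
      tauto
  · rw [if_neg (by simp)]
    refine coincidence_eq_zero (x := Sum.inl a) ?_
    simp only [inl_mem_range_update_castAdd, mem_range_rowSel_inl]
    tauto
  · by_cases ha : a = a'
    swap
    · rw [if_neg (by simp [ha])]
      refine Finset.sum_eq_zero fun i'' _ => coincidence_eq_zero (x := Sum.inl a') ?_
      simp only [inl_mem_range_update_castAdd]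
      tauto
    subst ha
    rw [Finset.sum_eq_single (other b)]
    · by_cases hb : b = b'
      · subst hb
        rw [if_pos rfl, coincidence_self]
        refine injective_update (rowSel_injective _) ?_
        rw [mem_range_rowSel_inr]
        exact (hother b).symm
      · rw [if_neg (by simpa using hb)]
        refine coincidence_eq_zero (x := Sum.inr b) ?_
        have := hother b
        simp only [inr_mem_range_update_castAdd]
        tauto
    · intro i'' _ hi''
      obtain ⟨c, hc, -⟩ := exists_ne_ne_of_three_le (h3 _ _ hi'') b'.2 b'.2
      refine coincidence_eq_zero (x := Sum.inr (other b, c)) ?_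
      simp only [inr_mem_range_update_castAdd, Prod.ext_iff]
      tauto
    · simp
  · rw [if_neg (by simp)]
    refine coincidence_eq_zero (x := Sum.inl a) ?_
    simp only [inl_mem_range_update_castAdd, inl_mem_range_update_natAdd]
    tauto
  · rw [if_neg (by simp)]
    simp only at hij
    obtain ⟨c'', hc'', -⟩ := exists_ne_ne_of_three_le (h3 _ _ hij) c c
    by_cases h : i = i'
    · subst h
      refine coincidence_eq_zero (x := Sum.inr (j, d)) ?_
      simp only [mem_range_rowSel_inr, inr_mem_range_update_natAdd]
      tauto
    · refine coincidence_eq_zero (x := Sum.inr (i, c'')) ?_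
      simp only [mem_range_rowSel_inr, inr_mem_range_update_natAdd, Prod.mk.injEq, ne_eq]
      tauto
  · rw [if_neg (by simp)]
    refine Finset.sum_eq_zero fun i'' _ => coincidence_eq_zero (x := Sum.inl a') ?_
    simp only [inl_mem_range_update_castAdd, inl_mem_range_update_natAdd]
    tauto
  · simp only at hij hij'
    by_cases hi : i = i'
    swap
    · rw [if_neg (by simp [hi])]
      -- The witness must avoid both the element removed from plane i and the one possibly added to
      -- plane i'; this is where three elements are needed.
      obtain ⟨c'', hc'', hd''⟩ := exists_ne_ne_of_three_le (h3 _ _ hij) c d'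
      refine coincidence_eq_zero (x := Sum.inr (i, c'')) ?_
      simp only [inr_mem_range_update_natAdd, Prod.mk.injEq, ne_eq]
      tauto
    subst hi
    by_cases hj : j = j' ∧ d = d'
    swap
    · rw [if_neg (by simp; tauto)]
      refine coincidence_eq_zero (x := Sum.inr (j, d)) ?_
      simp only [inr_mem_range_update_natAdd, Prod.mk.injEq, ne_eq]
      tauto
    obtain ⟨rfl, rfl⟩ := hj
    by_cases hc : c = c'
    · subst hc
      rw [if_pos rfl, coincidence_self]
      refine injective_update (rowSel_injective _) ?_
      rw [mem_range_rowSel_inr]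
      exact hij.symm
    · rw [if_neg (by simpa using hc)]
      refine coincidence_eq_zero (x := Sum.inr (i, c')) ?_
      simp only [inr_mem_range_update_natAdd, Prod.mk.injEq, ne_eq]
      tauto

-- The number of chart parameters bounds the transcendence degree from above, and the Jacobian
-- criterion shows that it is attained. Generic vectors reach the chart once the minors collected in
-- g are invertible.
open MvPolynomial in
theorem ringKrullDim_restrictedSecantPoints_chart {r s m : ℕ}
    (h : (2 ≤ s ∧ 3 ≤ m) ∨ (s = 1 ∧ m = 0)) :
    ringKrullDim (CoordinateRing (pluckerBasis (r + m) (r + s * m))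
      (restrictedSecantPoints (r + m) r s (r + s * m))) =
      (s + (r * (s * m) + m * m * (s * s - s)) : ℕ) := by
  have hother : ∀ b : Fin s × Fin m, ∃ i, i ≠ b.1 := by
    rintro ⟨i, c⟩
    rcases h with h | h
    · have : Nontrivial (Fin s) := Fin.nontrivial_iff_two_le.2 h.1
      exact exists_ne i
    · exact absurd c.2 (by omega)
  choose other hother using hother
  have hs : 1 ≤ s := by omega
  let i₀ : Fin s := ⟨0, hs⟩
  let σ : RowIdx r s m ≃ Fin (r + s * m) := Fintype.equivFinOfCardEq (by simp)
  let lam : Fin s → MvPolynomial (ChartIdx r s m) ℂ := fun i => X (Sum.inl i)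
  let G : RowIdx r s m → RowIdx r s m → MvPolynomial (ChartIdx r s m) ℂ := chartRow X
  have hev : ∀ (z : ChartIdx r s m → ℂ) t, eval z (plucker lam G t) =
      plucker (fun i => z (Sum.inl i)) (chartRow z) t := by
    intro z t
    rw [map_plucker]
    simp only [lam, G, map_chartRow, eval_X]
  have hind : AlgebraicIndependent ℂ fun d => plucker lam G (chartCoord other d) := by
    refine algebraicIndependent_of_jacobian _ id (chartOrigin r s m) fun d d' => ?_
    refine eval_pderiv_of_line (a := ∑ i, coincidence (rowSel i) (chartCoord other d)) fun τ => ?_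
    rw [hev, id_eq, plucker_chart_line, chartDeriv_chartCoord (by omega) hother]
  let gA : MvPolynomial (Fin s ⊕ RowIdx r s m × RowIdx r s m) ℂ :=
    (Matrix.of fun a a' : Fin r => genRow r s m (Sum.inl a) (Sum.inl a')).det
  let gC : Fin s → MvPolynomial (Fin s ⊕ RowIdx r s m × RowIdx r s m) ℂ := fun i =>
    (Matrix.of fun u v : Fin r ⊕ Fin m =>
      genRow r s m (Sum.map id (Prod.mk i) u) (Sum.map id (Prod.mk i) v)).det
  have hgA : ∀ z, eval z gA =
      (Matrix.of fun a a' : Fin r => z (Sum.inr (Sum.inl a, Sum.inl a'))).det := by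
    intro z
    rw [RingHom.map_det]
    congr 1
    ext a a'
    simp [genRow]
  have hgC : ∀ z i, eval z (gC i) = (Matrix.of fun u v : Fin r ⊕ Fin m =>
      z (Sum.inr (Sum.map id (Prod.mk i) u, Sum.map id (Prod.mk i) v))).det := by
    intro z i
    rw [RingHom.map_det]
    congr 1
    ext a a'
    simp [genRow]
  let z₁ : Fin s ⊕ RowIdx r s m × RowIdx r s m → ℂ :=
    Sum.elim 0 fun p => if p.1 = p.2 then 1 else 0
  refine ringKrullDim_restrictedSecantPoints (fun p hp => ?_) σ lam G
    ⟨chartCoord other (Sum.inl i₀), hind.ne_zero _⟩ (g := gA * ∏ i, gC i) ?_ ?_ ?_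
  · apply MvPolynomial.funext
    intro z
    simpa [aeval_eq_eval] using! hp (aeval z)
  · intro h0
    have h1 := congrArg (eval z₁) h0
    rw [map_mul, map_prod, map_zero, hgA] at h1
    have h2 : (Matrix.of fun a a' : Fin r =>
        z₁ (Sum.inr ((Sum.inl a : RowIdx r s m), Sum.inl a'))) = 1 := by
      ext a a'
      simp [z₁, Matrix.one_apply]
    have h3 : ∀ i : Fin s, eval z₁ (gC i) = 1 := by
      intro i
      rw [hgC, ← Matrix.det_one (n := Fin r ⊕ Fin m)]
      congr 1
      ext u v
      have hinj : Function.Injective (Sum.map (id : Fin r → Fin r) (Prod.mk (β := Fin m) i)) :=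
        Sum.map_injective.2 ⟨Function.injective_id, Prod.mk_right_injective i⟩
      simp [z₁, Matrix.one_apply, hinj.eq_iff]
    rw [h2, Matrix.det_one, one_mul, Finset.prod_eq_one fun i _ => h3 i] at h1
    exact one_ne_zero h1
  · intro lam' G' hz
    rw [map_mul, map_prod] at hz
    obtain ⟨z, hz'⟩ := exists_chart lam' G' (by simpa [hgA] using left_ne_zero_of_mul hz)
      (fun i => by
        have := Finset.prod_ne_zero_iff.1 (right_ne_zero_of_mul hz) i (Finset.mem_univ i)
        simpa [hgC] using this)
    refine ⟨aeval z, fun t => ?_⟩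
    rw [hz' t, ← hev]
    simp [aeval_eq_eval]
  · rw [← card_chartIdx]
    let A := pluckerAlgebra lam G
    apply le_antisymm
    · have := trdeg_le_of_injective (R := ℂ) A.val Subtype.val_injective
      rw [MvPolynomial.trdeg_of_isDomain] at this
      simpa using this
    · let P : ChartIdx r s m → A := fun d =>
        ⟨_, plucker_mem_pluckerAlgebra lam G (chartCoord other d)⟩
      have hP : AlgebraicIndependent ℂ P :=
        (AlgHom.algebraicIndependent_iff A.val Subtype.val_injective).1 hind
      have := hP.cardinalMk_le_trdeg
      rwa [Cardinal.mk_fintype] at this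

/-! ### Degenerate restricted secant varieties -/

theorem mk_smul_ιMulti_mem_grassmannian {k n : ℕ} (c : ℂ) (e : Fin k → V n)
    (h : c • exteriorPower.ιMulti ℂ k e ≠ 0) : Projectivization.mk ℂ _ h ∈ grassmannian k n := by
  have hω := right_ne_zero_of_smul h
  exact ⟨_, _, hω, ⟨e, ιMulti_ne_zero_iff.1 hω, rfl, rfl⟩,
    (Projectivization.mk_eq_mk_iff' ℂ _ _ h hω).2 ⟨c, rfl⟩⟩

theorem grassmannian_subset_restrictedSecantPoints {k r s : ℕ} (hr : r ≤ k) (hs : 1 ≤ s) (n : ℕ) :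
    grassmannian k n ⊆ restrictedSecantPoints k r s n := by
  rintro _ ⟨E, ω, hω, hE, rfl⟩
  let i₀ : Fin s := ⟨0, hs⟩
  have : Nonempty (Fin s) := ⟨i₀⟩
  have hsum : ∑ i : Fin s, (Pi.single i₀ 1 : Fin s → ℂ) i • ω = ω := by
    rw [← Finset.sum_smul, Finset.sum_pi_single']
    simp
  refine ⟨fun _ => E, fun _ => ω, Pi.single i₀ 1, hsum.symm ▸ hω, fun _ => hE, ?_, ?_⟩
  · obtain ⟨e, he, rfl, -⟩ := hE
    rwa [ciInf_const, finrank_span_eq_card he, Fintype.card_fin]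
  · congr 1
    exact hsum.symm

/-- For m = 1 the planes differ in one vector only, and multilinearity collects the sum in that
slot; for m = 0 all summands are proportional. -/
theorem exists_secantVector_eq_smul_ιMulti {n r s m : ℕ} (hs : 1 ≤ s) (h : s = 1 ∨ m ≤ 1)
    (lam : Fin s → ℂ) (G : RowIdx r s m → V n) :
    ∃ (c : ℂ) (e : Fin (r + m) → V n),
      secantVector lam G = c • exteriorPower.ιMulti ℂ (r + m) e := by
  rcases h with rfl | h
  · exact ⟨_, _, Fin.sum_univ_one _⟩
  let i₀ : Fin s := ⟨0, hs⟩
  obtain rfl | rfl : m = 0 ∨ m = 1 := by omega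
  · refine ⟨∑ i, lam i, fun q => G (rowSel i₀ q), ?_⟩
    rw [Finset.sum_smul]
    refine Finset.sum_congr rfl fun i _ => ?_
    congr 2
    ext q : 1
    refine Fin.addCases (fun l => ?_) (fun c => c.elim0) q
    rw [rowSel_castAdd, rowSel_castAdd]
  · let v : Fin (r + 1) → V n := fun q => G (rowSel i₀ q)
    refine ⟨1, Function.update v (Fin.natAdd r 0) (∑ i, lam i • G (Sum.inr (i, 0))), ?_⟩
    rw [one_smul, AlternatingMap.map_update_sum]
    refine Finset.sum_congr rfl fun i _ => ?_
    rw [AlternatingMap.map_update_smul]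
    congr 2
    ext q : 1
    refine Fin.addCases (fun l => ?_) (fun c => ?_) q
    · rw [Function.update_of_ne (by simp [Fin.ext_iff]; omega)]
      simp only [v, rowSel_castAdd]
    · obtain rfl := Subsingleton.elim c 0
      rw [Function.update_self, rowSel_natAdd]

theorem restrictedSecantPoints_eq_grassmannian {r s m : ℕ} (hs : 1 ≤ s) (h : s = 1 ∨ m ≤ 1)
    (n : ℕ) : restrictedSecantPoints (r + m) r s n = grassmannian (r + m) n := by
  refine subset_antisymm (fun x hx => ?_)
    (grassmannian_subset_restrictedSecantPoints (Nat.le_add_right r m) hs n)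
  induction x with | h w hw =>
  obtain ⟨lam, G, rfl⟩ := exists_secantVector_of_mem hx
  obtain ⟨c, e, he⟩ := exists_secantVector_eq_smul_ιMulti hs h lam G
  have := mk_smul_ιMulti_mem_grassmannian c e (he ▸ hw)
  simpa only [he] using this

/-- The right-hand side is the case s = 1, m = 0, to which the results on nondegenerate families
apply. -/
theorem restrictedSecant_eq_of_degenerate {r s m : ℕ} (hs : 1 ≤ s) (h : s = 1 ∨ m ≤ 1) :
    restrictedSecant (r + m) r s = restrictedSecant (r + m) (r + m) 1 := by
  ext1 n
  have h1 : restrictedSecantPoints (r + m) (r + m) 1 n = grassmannian (r + m) n :=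
    restrictedSecantPoints_eq_grassmannian (m := 0) le_rfl (Or.inl rfl) n
  rw [restrictedSecant, restrictedSecant, restrictedSecantPoints_eq_grassmannian hs h, h1]

/-! ### Orbit stability and dimensions -/

theorem eq_of_isLeast_orbitStableAt {r s m p : ℕ} (hs : 1 ≤ s) (hgen : s = 1 ∨ 2 ≤ m)
    (hp : IsLeast {q | OrbitStableAt (r + m) r s q} p) : p = r + s * m := by
  refine le_antisymm (hp.2 (orbitStableAt r s m)) ?_
  by_contra! h
  exact not_orbitStableAt hs hgen h hp.1

/-- The same d serves every n, so it can be identified from the chart at n = N, that is e = 0. -/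
theorem exists_projDim_restrictedSecant_eq {r s m : ℕ} (hs : 1 ≤ s) (hgen : s = 1 ∨ 2 ≤ m) :
    ∃ d : ℕ, (∀ n, r + s * m ≤ n →
      projDim (pluckerBasis (r + m) n) (restrictedSecant (r + m) r s n) =
        (d + (r + s * m) * (n - (r + s * m)) : ℕ)) ∧
      ((2 ≤ s ∧ 3 ≤ m) ∨ (s = 1 ∧ m = 0) →
        d = s - 1 + (r * (s * m) + m * m * (s * s - s))) := by
  obtain ⟨d, hd1, hd⟩ := exists_trdeg_pluckerAlgebra_gen (r := r) (m := m) hs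
  refine ⟨d - 1, fun n hn => ?_, fun h => ?_⟩
  · obtain ⟨e, rfl⟩ := Nat.exists_eq_add_of_le hn
    rw [restrictedSecant, projDim_zariskiClosure, projDim,
      ringKrullDim_restrictedSecantPoints_add hs hgen hd, Nat.add_sub_cancel_left,
      ← Nat.sub_add_comm hd1]
    rfl
  · have h1 := ringKrullDim_restrictedSecantPoints_add hs hgen hd 0
    have h2 := ringKrullDim_restrictedSecantPoints_chart (r := r) h
    rw [add_zero, h2] at h1
    have h3 : s + (r * (s * m) + m * m * (s * s - s)) = d + (r + s * m) * 0 := by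
      exact_mod_cast h1
    omega

theorem projDim_grassmannian {p n : ℕ} (h : p ≤ n) :
    projDim (pluckerBasis p n) (grassmannian p n) = (p * (n - p) : ℕ) := by
  obtain ⟨d, hd, hd'⟩ := exists_projDim_restrictedSecant_eq (r := p) (s := 1) (m := 0) le_rfl
    (Or.inl rfl)
  have h0 : d = 0 := by simpa using hd' (Or.inr ⟨rfl, rfl⟩)
  have h1 := hd n h
  rw [restrictedSecant, projDim_zariskiClosure,
    restrictedSecantPoints_eq_grassmannian le_rfl (Or.inl rfl), h0, Nat.zero_add] at h1
  exact h1

end RestrictedSecant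

end

open RestrictedSecant

theorem mainTheorem4 (k r s : ℕ) (hr : r ≤ k) (hs : 1 ≤ s) :
    RestrictedSecant.OrbitStableAt k r s (r + s * (k - r)) ∧
    ∀ p : ℕ, IsLeast {q : ℕ | RestrictedSecant.OrbitStableAt k r s q} p →
      ((s = 1 ∨ k ≠ r + 1) → p = r + s * (k - r)) ∧
      ∀ n : ℕ, p ≤ n →
        RestrictedSecant.projDim (RestrictedSecant.pluckerBasis k n)
            (RestrictedSecant.restrictedSecant k r s n) =
          RestrictedSecant.projDim (RestrictedSecant.pluckerBasis k p)
              (RestrictedSecant.restrictedSecant k r s p) +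
            RestrictedSecant.projDim (RestrictedSecant.pluckerBasis p n)
              (RestrictedSecant.grassmannian p n) ∧
        ((2 ≤ s ∧ r + 3 ≤ k) ∨ (s = 1 ∧ (r = 0 ∨ r = k)) →
          RestrictedSecant.projDim (RestrictedSecant.pluckerBasis k n)
              (RestrictedSecant.restrictedSecant k r s n) =
            ((r * (p - r) + s * ((k - r) * (p - k)) + (s - 1) + p * (n - p) : ℕ) :
              WithBot ℕ∞)) := by
  obtain ⟨m, rfl⟩ := Nat.exists_eq_add_of_le hr
  rw [Nat.add_sub_cancel_left]
  refine ⟨orbitStableAt r s m, fun p hp => ?_⟩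
  -- The split is by whether the variety collapses to Gr(k, n). In that case the first stable step
  -- is k, which equals r + s m unless s ≥ 2 and m = 1.
  by_cases hc : s = 1 ∨ m ≤ 1
  · have heq := restrictedSecant_eq_of_degenerate (r := r) hs hc
    have hst : ∀ q, OrbitStableAt (r + m) r s q ↔ OrbitStableAt (r + m) (r + m) 1 q := by
      intro q
      rw [OrbitStableAt, OrbitStableAt, heq]
    simp only [hst] at hp
    have hpk : p = r + m :=
      eq_of_isLeast_orbitStableAt (r := r + m) (m := 0) le_rfl (Or.inl rfl) hp
    obtain ⟨d, hd, hd'⟩ := exists_projDim_restrictedSecant_eq (r := r + m) (s := 1) (m := 0)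
      le_rfl (Or.inl rfl)
    have h0 : d = 0 := by simpa using hd' (Or.inr ⟨rfl, rfl⟩)
    have hdim : ∀ n, p ≤ n → projDim (pluckerBasis (r + m) n) (restrictedSecant (r + m) r s n) =
        (p * (n - p) : ℕ) := by
      intro n hn
      rw [heq, hpk]
      simpa [h0] using hd n (hpk ▸ hn)
    refine ⟨fun h => ?_, fun n hn => ⟨?_, fun h => ?_⟩⟩
    · obtain rfl | rfl : s = 1 ∨ m = 0 := by omega
      · rw [hpk, one_mul]
      · simpa using hpk
    · rw [hdim n hn, hdim p le_rfl, projDim_grassmannian hn, Nat.sub_self, mul_zero]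
      simp
    · have h1 : s - 1 = 0 ∧ r * (p - r) = 0 := by
        refine ⟨by omega, ?_⟩
        rcases (show r = 0 ∨ p = r by omega) with h1 | h1 <;> simp [h1]
      rw [hdim n hn, h1.1, h1.2, show p - (r + m) = 0 by omega]
      simp
  · have hp' : p = r + s * m := eq_of_isLeast_orbitStableAt hs (by omega) hp
    subst hp'
    obtain ⟨d, hd, hd'⟩ := exists_projDim_restrictedSecant_eq (r := r) (s := s) (m := m) hs
      (by omega)
    refine ⟨fun _ => rfl, fun n hn => ⟨?_, fun h => ?_⟩⟩
    · rw [hd n hn, hd _ le_rfl, projDim_grassmannian hn, Nat.sub_self, mul_zero, add_zero]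
      push_cast
      rfl
    -- With s = t + 1 the truncated subtractions become p - k = t m and s² - s = (t + 1) t, and the
    -- chart count matches the claimed formula.
    · obtain ⟨t, rfl⟩ : ∃ t, s = t + 1 := ⟨s - 1, by omega⟩
      rw [hd n hn, hd' (by omega)]
      have h1 : r + (t + 1) * m - (r + m) = t * m := by
        rw [add_mul, one_mul]; omega
      have h2 : (t + 1) * (t + 1) - (t + 1) = (t + 1) * t := by
        rw [mul_add, mul_one, Nat.add_sub_cancel]
      rw [h1, h2, Nat.add_sub_cancel_left]
      congr 2
      ring
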